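/- For real or complex $z$ write $\langle z\rangle=(1+|z|^2)^{1/2}$. For $\beta\in\mathbb R$ let $S^\beta$ be the set of smooth functions $f:\mathbb R\to\mathbb C$ such that for every integer $n\ge 0$ there is $c_n>0$ with $|f^{(n)}(x)|\le c_n\langle x\rangle^{\beta-n}$ for all $x\in\mathbb R$. Let $\mathcal A=\bigcup_{\beta<0}S^\beta$, an algebra under pointwise operations, and let $\hat{\mathcal A}=\{(\gamma,f):\gamma\in\mathbb C,\ f\in\mathcal A\}$ be its unitization, whose elements act as functions $(\gamma,f)(x)=\gamma+f(x)$ on $\mathbb R$. Let $H$ be a closed, densely defined operator on a complex Banach space $\mathcal B$ with spectrum $\sigma(H)\subseteq\mathbb R$, and suppose that for some constants $c$ and $\alpha\ge 0$ $$\|(z-H)^{-1}\|\le c\,|\mathrm{Im}\,z|^{-1}\Big(\frac{\langle z\rangle}{|\mathrm{Im}\,z|}\Big)^{\alpha}\qquad\text{for all } z\in\mathbb C\setminus\mathbb R .$$ Let $n>\alpha$ be an integer, and let $\tau:\mathbb R^2\to\mathbb R$ be a smooth function with $\tau(x,y)=1$ if $|y|\le\langle x\rangle$, $\tau(x,y)=0$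 if $|y|\ge 2\langle x\rangle$, and $|\partial_x\tau(x,y)|+|\partial_y\tau(x,y)|\le K\langle x\rangle^{-1}$ for all $x,y$ and some constant $K$ (for instance $\tau(x,y)=\tau_0(y/\langle x\rangle)$ with $\tau_0$ smooth on $\mathbb R$, $\tau_0=1$ on $[-1,1]$ and $\tau_0=0$ off $(-2,2)$). For $f\in\mathcal A$ put $$\tilde f(x,y)=\Big(\sum_{r=0}^{n}f^{(r)}(x)\frac{(iy)^r}{r!}\Big)\tau(x,y),\qquad \frac{\partial\tilde f}{\partial\bar z}=\frac12\Big(\frac{\partial\tilde f}{\partial x}+i\frac{\partial\tilde f}{\partial y}\Big),$$ $$f(H)=-\frac1\pi\iint_{\mathbb C}\frac{\partial\tilde f}{\partial\bar z}\,(z-H)^{-1}\,dx\,dy ,$$ and for $\phi=(\gamma,f)\in\hat{\mathcal A}$ put $\phi(H)=\gamma I+f(H)$. Theorem. For every $\phi=(\gamma,f)\in\hat{\mathcal A}$ the integral defining $f(H)$ is absolutely convergent in operator norm, and $$\sigma(\phi(H))\subseteq\overline{\phi(\sigma(H))}.$$ This holds for every choice of such $n$ and $\tau$. -/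

import Mathlib

open MeasureTheory
open scoped ContDiff

namespace HelfferSjostrand

noncomputable section

/-- The bracket `⟨z⟩ = (1 + |z|²)^{1/2}`, for real or complex `z`. -/
def bracket {E : Type*} [Norm E] (z : E) : ℝ := Real.sqrt (1 + ‖z‖ ^ 2)

theorem one_le_bracket (x : ℝ) : 1 ≤ bracket x := by
  unfold bracket
  rw [Real.one_le_sqrt]
  nlinarith [sq_nonneg ‖x‖]

theorem bracket_pos (x : ℝ) : 0 < bracket x := lt_of_lt_of_le one_pos (one_le_bracket x)

/-! ### Slowly decaying smooth functions -/

/-- `S^β`: the smooth functions `f : ℝ → ℂ` such that for every `n` there is `c > 0` with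
`|f^{(n)}(x)| ≤ c ⟨x⟩^{β - n}` for all `x`. -/
def symbolClass (β : ℝ) : Set (ℝ → ℂ) :=
  {f | ContDiff ℝ ∞ f ∧
    ∀ n : ℕ, ∃ c : ℝ, 0 < c ∧ ∀ x : ℝ, ‖iteratedDeriv n f x‖ ≤ c * bracket x ^ (β - (n : ℝ))}

theorem symbolClass_mono {β γ : ℝ} (h : β ≤ γ) : symbolClass β ⊆ symbolClass γ := by
  rintro f ⟨hf, hb⟩
  refine ⟨hf, fun n => ?_⟩
  obtain ⟨c, hc, hcb⟩ := hb n
  refine ⟨c, hc, fun x => (hcb x).trans ?_⟩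
  gcongr
  exact one_le_bracket x

theorem symbolClass_add {β : ℝ} {f g : ℝ → ℂ} (hf : f ∈ symbolClass β) (hg : g ∈ symbolClass β) :
    f + g ∈ symbolClass β := by
  refine ⟨hf.1.add hg.1, fun n => ?_⟩
  obtain ⟨c, hc, hcb⟩ := hf.2 n
  obtain ⟨d, hd, hdb⟩ := hg.2 n
  refine ⟨c + d, by positivity, fun x => ?_⟩
  rw [iteratedDeriv_add (hf.1.of_le (by exact_mod_cast le_top)).contDiffAt
    (hg.1.of_le (by exact_mod_cast le_top)).contDiffAt, add_mul]
  exact (norm_add_le _ _).trans (add_le_add (hcb x) (hdb x))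

theorem symbolClass_smul {β : ℝ} (a : ℂ) {f : ℝ → ℂ} (hf : f ∈ symbolClass β) :
    a • f ∈ symbolClass β := by
  refine ⟨hf.1.const_smul a, fun n => ?_⟩
  obtain ⟨c, hc, hcb⟩ := hf.2 n
  refine ⟨(‖a‖ + 1) * c, by positivity, fun x => ?_⟩
  rw [iteratedDeriv_const_smul_field, norm_smul, mul_assoc]
  have := hcb x
  gcongr
  linarith

theorem symbolClass_mul {β γ : ℝ} {f g : ℝ → ℂ} (hf : f ∈ symbolClass β)
    (hg : g ∈ symbolClass γ) : f * g ∈ symbolClass (β + γ) := by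
  refine ⟨hf.1.mul hg.1, fun n => ?_⟩
  choose c hc hcb using hf.2
  choose d hd hdb using hg.2
  refine ⟨∑ i ∈ Finset.range (n + 1), (n.choose i : ℝ) * c i * d (n - i), ?_, fun x => ?_⟩
  · refine Finset.sum_pos (fun i hi => ?_) ⟨0, by simp⟩
    have := Nat.choose_pos (Nat.lt_succ_iff.mp (Finset.mem_range.mp hi))
    have := hc i
    have := hd (n - i)
    positivity
  · rw [iteratedDeriv_mul (hf.1.of_le (by exact_mod_cast le_top)).contDiffAt
      (hg.1.of_le (by exact_mod_cast le_top)).contDiffAt, Finset.sum_mul]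
    refine (norm_sum_le _ _).trans (Finset.sum_le_sum fun i hi => ?_)
    have hi' : i ≤ n := Nat.lt_succ_iff.mp (Finset.mem_range.mp hi)
    have hexp : bracket x ^ (β + γ - (n : ℝ))
        = bracket x ^ (β - (i : ℝ)) * bracket x ^ (γ - ((n - i : ℕ) : ℝ)) := by
      rw [← Real.rpow_add (bracket_pos x), Nat.cast_sub hi']
      congr 1
      ring
    rw [norm_mul, norm_mul, Complex.norm_natCast, hexp]
    calc (n.choose i : ℝ) * ‖iteratedDeriv i f x‖ * ‖iteratedDeriv (n - i) g x‖
        ≤ (n.choose i : ℝ) * (c i * bracket x ^ (β - (i : ℝ)))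
            * (d (n - i) * bracket x ^ (γ - ((n - i : ℕ) : ℝ))) := by
          have h1 := hcb i x
          have h2 := hdb (n - i) x
          have h3 := hc i
          have h4 := bracket_pos x
          gcongr
      _ = _ := by ring

theorem zero_mem_symbolClass (β : ℝ) : (0 : ℝ → ℂ) ∈ symbolClass β := by
  refine ⟨contDiff_const, fun n => ⟨1, one_pos, fun x => ?_⟩⟩
  have h : iteratedDeriv n (0 : ℝ → ℂ) x = 0 := by
    simpa only [zero_smul] using iteratedDeriv_const_smul_field (n := n) (x := x) (0 : ℂ) (0 : ℝ → ℂ)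
  rw [h, norm_zero, one_mul]
  exact Real.rpow_nonneg (bracket_pos x).le _

/-- The algebra `𝒜 = ⋃_{β < 0} S^β` of slowly decaying smooth functions, under pointwise
operations. -/
def slowAlgebra : NonUnitalSubalgebra ℂ (ℝ → ℂ) where
  carrier := ⋃ β : ℝ, ⋃ _ : β < 0, symbolClass β
  zero_mem' := by
    simp only [Set.mem_iUnion]
    exact ⟨-1, by norm_num, zero_mem_symbolClass _⟩
  add_mem' := by
    simp only [Set.mem_iUnion]
    rintro f g ⟨β, hβ, hf⟩ ⟨γ, hγ, hg⟩
    exact ⟨max β γ, max_lt hβ hγ, symbolClass_add (symbolClass_mono (le_max_left _ _) hf)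
      (symbolClass_mono (le_max_right _ _) hg)⟩
  mul_mem' := by
    simp only [Set.mem_iUnion]
    rintro f g ⟨β, hβ, hf⟩ ⟨γ, hγ, hg⟩
    exact ⟨β + γ, by linarith, symbolClass_mul hf hg⟩
  smul_mem' := by
    simp only [Set.mem_iUnion]
    rintro a f ⟨β, hβ, hf⟩
    exact ⟨β, hβ, symbolClass_smul a hf⟩

/-- The unitized algebra `Â` of pairs `(z, f)` with `z ∈ ℂ` and `f ∈ 𝒜`, with the product
`(w, f) (z, g) = (w z, w g + z f + f g)`. -/
abbrev slowAlgebraHat : Type := Unitization ℂ slowAlgebra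

/-- The function `(z, f)(x) = z + f(x)` on `ℝ`. -/
def evalHat (φ : slowAlgebraHat) (x : ℝ) : ℂ := φ.fst + (φ.snd : ℝ → ℂ) x

/-! ### Almost analytic extensions -/

/-- Cut-off functions `τ(x, y)`: smooth, equal to `1` where `|y| ≤ ⟨x⟩` and to `0` where
`|y| ≥ 2⟨x⟩`, with first partial derivatives of size `O(⟨x⟩⁻¹)`.  The functions
`τ₀(y / ⟨x⟩)`, with `τ₀` smooth, `τ₀ = 1` on `[-1, 1]` and `τ₀ = 0` off `(-2, 2)`, are of
this kind. -/
structure IsCutoff (τ : ℝ → ℝ → ℝ) : Prop where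
  smooth : ContDiff ℝ ∞ (fun p : ℝ × ℝ => τ p.1 p.2)
  eq_one : ∀ x y : ℝ, |y| ≤ bracket x → τ x y = 1
  eq_zero : ∀ x y : ℝ, 2 * bracket x ≤ |y| → τ x y = 0
  deriv_bound : ∃ K : ℝ, ∀ x y : ℝ,
    |deriv (fun t : ℝ => τ t y) x| ≤ K / bracket x ∧ |deriv (fun t : ℝ => τ x t) y| ≤ K / bracket x

/-- The almost analytic extension
`f̃(x, y) = (∑_{r = 0}^{n} f^{(r)}(x) (i y)^r / r!) τ(x, y)`. -/
def almostAnalytic (n : ℕ) (τ : ℝ → ℝ → ℝ) (f : ℝ → ℂ) (x y : ℝ) : ℂ :=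
  (∑ r ∈ Finset.range (n + 1),
    iteratedDeriv r f x * (Complex.I * (y : ℂ)) ^ r / (r.factorial : ℂ)) * (τ x y : ℂ)

/-- `∂F/∂z̄ = (∂F/∂x + i ∂F/∂y) / 2`. -/
def dbar (F : ℝ → ℝ → ℂ) (x y : ℝ) : ℂ :=
  (1 / 2 : ℂ) * (deriv (fun t : ℝ => F t y) x + Complex.I * deriv (fun t : ℝ => F x t) y)

/-! ### Resolvent and spectrum of an unbounded operator -/

section Operator

variable {B : Type*} [NormedAddCommGroup B] [NormedSpace ℂ B]

/-- `R` is a bounded two-sided inverse of `z - H : Dom(H) → B`. -/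
def IsResolventAt (H : B →ₗ.[ℂ] B) (z : ℂ) (R : B →L[ℂ] B) : Prop :=
  (∀ v : B, ∃ hv : R v ∈ H.domain, z • R v - H ⟨R v, hv⟩ = v) ∧
    ∀ u : H.domain, R (z • (u : B) - H u) = (u : B)

theorem IsResolventAt.unique {H : B →ₗ.[ℂ] B} {z : ℂ} {R R' : B →L[ℂ] B}
    (h : IsResolventAt H z R) (h' : IsResolventAt H z R') : R = R' := by
  ext v
  obtain ⟨hv, e⟩ := h.1 v
  have := h'.2 ⟨R v, hv⟩
  rw [e] at this
  exact this.symm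

/-- The resolvent set of `H`. -/
def resolventSetOf (H : B →ₗ.[ℂ] B) : Set ℂ := {z | ∃ R : B →L[ℂ] B, IsResolventAt H z R}

/-- The spectrum `σ(H)`. -/
def spectrumOf (H : B →ₗ.[ℂ] B) : Set ℂ := (resolventSetOf H)ᶜ

open Classical in
/-- The resolvent operator `(z - H)⁻¹` for `z` in the resolvent set (and `0` elsewhere). -/
def resolventOf (H : B →ₗ.[ℂ] B) (z : ℂ) : B →L[ℂ] B :=
  if h : ∃ R : B →L[ℂ] B, IsResolventAt H z R then h.choose else 0

theorem resolventOf_spec {H : B →ₗ.[ℂ] B} {z : ℂ} (hz : z ∈ resolventSetOf H) :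
    IsResolventAt H z (resolventOf H z) := by
  have h : ∃ R : B →L[ℂ] B, IsResolventAt H z R := hz
  unfold resolventOf
  rw [dif_pos h]
  exact h.choose_spec

/-! ### The functional calculus -/

/-- The integrand `(∂f̃/∂z̄)(z) (z - H)⁻¹`, where `z = x + i y`. -/
def calcIntegrand (H : B →ₗ.[ℂ] B) (n : ℕ) (τ : ℝ → ℝ → ℝ) (f : ℝ → ℂ) (z : ℂ) : B →L[ℂ] B :=
  dbar (almostAnalytic n τ f) z.re z.im • resolventOf H z

/-- `f(H) = -π⁻¹ ∬ (∂f̃/∂z̄) (z - H)⁻¹ dx dy`, for `f ∈ 𝒜`. -/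
def funcCalc (H : B →ₗ.[ℂ] B) (n : ℕ) (τ : ℝ → ℝ → ℝ) (f : slowAlgebra) : B →L[ℂ] B :=
  -((1 / Real.pi : ℝ) : ℂ) • ∫ z : ℂ, calcIntegrand H n τ (f : ℝ → ℂ) z

/-- `φ(H) = c I + f(H)`, for `φ = (c, f) ∈ Â`. -/
def funcCalcHat (H : B →ₗ.[ℂ] B) (n : ℕ) (τ : ℝ → ℝ → ℝ) (φ : slowAlgebraHat) : B →L[ℂ] B :=
  φ.fst • (1 : B →L[ℂ] B) + funcCalc H n τ φ.snd

end Operator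

end

end HelfferSjostrand

/-!
The spectral inclusion is proved by Gelfand theory rather than through the multiplicativity of the
calculus. The double commutant of the resolvents `R(z) = (z - H)⁻¹` is a commutative Banach algebra,
closed under inverses, and it contains `φ(H)`. Hence each `λ ∈ σ(φ(H))` is the value `χ(φ(H))` of a
character `χ` of this algebra (`exists_algHom_eq_of_mem_spectrum`). The function `r(z) = χ(R(z))`
satisfies the scalar resolvent identity, so either `r = 0` or `r(z) = (z - μ)⁻¹` for some `μ` outside
the resolvent set, that is, `μ ∈ σ(H) ⊆ ℝ` (`eq_zero_or_eq_inv_sub_of_resolvent_identity`). Since `χ`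
commutes with the integral, `χ(φ(H)) = γ - π⁻¹ ∬ (∂f̃/∂z̄) r(z) dx dy`.

* If `r(z) = (z - μ)⁻¹`, the Cauchy–Pompeiu formula (`integral_dbar_smul_inv`) evaluates this as
  `γ + f(μ) = φ(μ)`, a point of `φ(σ(H))`.
* If `r = 0`, then `λ = γ`. When `σ(H)` is unbounded, `γ` is a limit of values of `φ` on `σ(H)`
  because `f` vanishes at infinity. When `σ(H)` is bounded, the growth bound on the resolvent improves
  to `R(z) = O(1 / |z|)` (`exists_norm_resolventOf_le_div`), so `z R(z)` has a limit at infinity, which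
  must be the identity; some `R(z)` is then invertible (`exists_isUnit_resolventOf`), which is
  impossible for an operator killed by a character.

Absolute convergence (`integrable_dbar_smul`) rests on the bound
`∂f̃/∂z̄ = O(⟨x⟩^{β - 1} (|y| / ⟨x⟩)^n)` on `|y| ≤ 2⟨x⟩`: with `t = |y| / ⟨x⟩` the integrand is
`O(⟨x⟩^{β - 2} t^{n - 1 - α})`, which is integrable because `n > α` and `β < 0`.
-/

open Filter Topology

namespace HelfferSjostrand

/-! ### Resolvents -/

section Resolvent

variable {B : Type*} [NormedAddCommGroup B] [NormedSpace ℂ B] {H : B →ₗ.[ℂ] B}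

theorem resolventOf_eq_zero {z : ℂ} (hz : z ∉ resolventSetOf H) : resolventOf H z = 0 :=
  dif_neg hz

/-- The resolvent identity, solved for `R(w)`. -/
theorem resolventOf_mul_one_add {z w : ℂ} (hz : z ∈ resolventSetOf H) (hw : w ∈ resolventSetOf H) :
    resolventOf H z * (1 + (z - w) • resolventOf H w) = resolventOf H w := by
  ext v
  obtain ⟨hv, e⟩ := (resolventOf_spec hw).1 v
  have h2 := (resolventOf_spec hz).2 ⟨resolventOf H w v, hv⟩
  have h3 : z • resolventOf H w v - H ⟨resolventOf H w v, hv⟩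
      = v + (z - w) • resolventOf H w v := by
    rw [sub_smul, sub_eq_iff_eq_add]
    rw [sub_eq_iff_eq_add] at e
    rw [show v + (z • resolventOf H w v - w • resolventOf H w v) + H ⟨resolventOf H w v, hv⟩
      = (v + H ⟨resolventOf H w v, hv⟩) + (z • resolventOf H w v - w • resolventOf H w v) by abel,
      ← e]
    abel
  simp only [h3] at h2
  simpa using h2

theorem resolventOf_commute {z w : ℂ} (hz : z ∈ resolventSetOf H) (hw : w ∈ resolventSetOf H) :
    resolventOf H z * resolventOf H w = resolventOf H w * resolventOf H z := by
  rcases eq_or_ne z w with rfl | hne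
  · rfl
  have h1 := resolventOf_mul_one_add hz hw
  have h2 := resolventOf_mul_one_add hw hz
  rw [mul_add, mul_one, mul_smul_comm] at h1 h2
  have h3 : (z - w) • (resolventOf H z * resolventOf H w)
      = (z - w) • (resolventOf H w * resolventOf H z) := by
    have e1 := eq_sub_of_add_eq' h1
    have e2 := eq_sub_of_add_eq' h2
    rw [e1, ← neg_sub w z, neg_smul, e2, neg_sub]
  exact smul_right_injective _ (sub_ne_zero.2 hne) h3

theorem differentiableOn_resolventOf [CompleteSpace B] {U : Set ℂ} (hU : IsOpen U)
    (h : U ⊆ resolventSetOf H) : DifferentiableOn ℂ (resolventOf H) U := by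
  intro w hw
  refine DifferentiableAt.differentiableWithinAt ?_
  have hinner : Differentiable ℂ fun z : ℂ => (1 : B →L[ℂ] B) + (z - w) • resolventOf H w := by
    fun_prop
  have hd : DifferentiableAt ℂ
      (fun z => resolventOf H w * Ring.inverse (1 + (z - w) • resolventOf H w)) w := by
    refine DifferentiableAt.const_mul ?_ _
    refine DifferentiableAt.fun_comp' (g := Ring.inverse) w ?_ (hinner w)
    exact differentiableAt_inverse (by simp)
  refine hd.congr_of_eventuallyEq ?_
  have hunit : ∀ᶠ z in 𝓝 w, IsUnit ((1 : B →L[ℂ] B) + (z - w) • resolventOf H w) := by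
    refine hinner.continuous.continuousAt.eventually_mem (Units.isOpen.mem_nhds ?_)
    simp
  filter_upwards [hunit, hU.mem_nhds hw] with z hz hzU
  calc resolventOf H z = resolventOf H z * (1 + (z - w) • resolventOf H w)
        * Ring.inverse (1 + (z - w) • resolventOf H w) := by
        rw [mul_assoc, Ring.mul_inverse_cancel _ hz, mul_one]
    _ = _ := by rw [resolventOf_mul_one_add (h hzU) (h hw)]

/-- A polynomial growth bound on the resolvent near the real axis improves, at infinity, to the
bound `O(1 / |z|)` when the spectrum is bounded: apply the maximum principle on a disc of radius
`r` about a real centre `x` to `((w - x)² - r²)^(n + 1) R(w)`, whose scalar factor vanishes where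
the boundary circle meets the real axis. -/
theorem exists_norm_resolventOf_le_div [CompleteSpace B] {M c α : ℝ} {n : ℕ} (hM : 1 ≤ M)
    (hc : 0 ≤ c) (hα : α ≤ n)
    (hU : {z : ℂ | M < ‖z‖} ⊆ resolventSetOf H)
    (hres : ∀ z : ℂ, z.im ≠ 0 →
      ‖resolventOf H z‖ ≤ c * |z.im|⁻¹ * (bracket z / |z.im|) ^ α) :
    ∃ C : ℝ, ∀ z : ℂ, 4 * M < ‖z‖ → ‖resolventOf H z‖ ≤ C / ‖z‖ := by
  have hbr : ∀ z : ℂ, 1 ≤ ‖z‖ → bracket z ≤ 2 * ‖z‖ := by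
    intro z hz
    unfold bracket
    rw [Real.sqrt_le_left (by positivity)]
    nlinarith
  have hres' : ∀ z : ℂ, 1 ≤ ‖z‖ → z.im ≠ 0 →
      ‖resolventOf H z‖ ≤ c * |z.im|⁻¹ * (2 * ‖z‖ / |z.im|) ^ n := by
    intro z h1 hz
    have hp : 0 < |z.im| := abs_pos.2 hz
    have hb : |z.im| ≤ bracket z := by
      unfold bracket
      refine Real.le_sqrt_of_sq_le ?_
      have := Complex.abs_im_le_norm z
      nlinarith [abs_nonneg z.im]
    refine (hres z hz).trans ?_
    gcongr
    calc (bracket z / |z.im|) ^ α ≤ (bracket z / |z.im|) ^ (n : ℝ) :=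
          Real.rpow_le_rpow_of_exponent_le ((one_le_div hp).2 hb) hα
      _ = (bracket z / |z.im|) ^ n := Real.rpow_natCast _ _
      _ ≤ _ := by
          have := hbr z h1
          have h0 : 0 ≤ bracket z := Real.sqrt_nonneg _
          gcongr
  -- The two constants belong to the regions `‖z‖ ≤ 5 |Im z|` and `‖z‖ > 5 |Im z|`.
  refine ⟨max (5 * c * 10 ^ n) (3 * c * 2 ^ (n + 1) * 6 ^ n), fun z hz => ?_⟩
  have hz0 : 0 < ‖z‖ := by linarith
  by_cases hcase : ‖z‖ ≤ 5 * |z.im|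
  · have hp : 0 < |z.im| := by linarith
    have h5 : |z.im|⁻¹ ≤ 5 / ‖z‖ := by
      rw [inv_eq_one_div, div_le_div_iff₀ hp hz0]; linarith
    calc ‖resolventOf H z‖ ≤ c * |z.im|⁻¹ * (2 * ‖z‖ / |z.im|) ^ n :=
          hres' z (by linarith) (abs_pos.1 hp)
      _ ≤ c * (5 / ‖z‖) * 10 ^ n := by
          gcongr
          rw [div_le_iff₀ hp]; linarith
      _ = (5 * c * 10 ^ n) / ‖z‖ := by ring
      _ ≤ _ := by gcongr; exact le_max_left _ _
  · push Not at hcase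
    set x : ℝ := z.re with hx
    have hxz : ‖z‖ ≤ |x| + |z.im| := Complex.norm_le_abs_re_add_abs_im z
    set r : ℝ := |x| / 2 with hr
    have hr0 : 0 < r := by rw [hr]; linarith [abs_nonneg x]
    have hrz : ‖z‖ ≤ 3 * r := by rw [hr]; linarith
    have himr : |z.im| < r := by rw [hr]; linarith
    have hxn : ‖(x : ℂ)‖ = 2 * r := by rw [Complex.norm_real, Real.norm_eq_abs, hr]; ring
    set g : ℂ → (B →L[ℂ] B) := fun w => ((w - x) ^ 2 - (r : ℂ) ^ 2) ^ (n + 1) • resolventOf H w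
      with hg
    have hball : Metric.closedBall (x : ℂ) r ⊆ {z : ℂ | M < ‖z‖} := by
      intro w hw
      rw [Metric.mem_closedBall, dist_eq_norm] at hw
      have : ‖(x : ℂ)‖ ≤ ‖w‖ + ‖w - x‖ := by
        calc ‖(x : ℂ)‖ = ‖w - (w - x)‖ := by congr 1; ring
          _ ≤ _ := norm_sub_le _ _
      simp only [Set.mem_ofPred_eq]
      linarith
    have hopen : IsOpen {z : ℂ | M < ‖z‖} := isOpen_lt continuous_const continuous_norm
    have hfd : Differentiable ℂ fun w : ℂ => ((w - x) ^ 2 - (r : ℂ) ^ 2) ^ (n + 1) := by fun_prop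
    have hdg : DifferentiableOn ℂ g {z : ℂ | M < ‖z‖} :=
      hfd.differentiableOn.smul (differentiableOn_resolventOf hopen hU)
    have hd : DiffContOnCl ℂ g (Metric.ball (x : ℂ) r) := hdg.diffContOnCl_ball hball
    have hbound : ∀ w ∈ frontier (Metric.ball (x : ℂ) r),
        ‖g w‖ ≤ c * 2 ^ (n + 1) * 6 ^ n * r ^ (2 * n + 1) := by
      intro w hw
      rw [frontier_ball _ hr0.ne', Metric.mem_sphere, dist_eq_norm] at hw
      have him : (w - x).im = w.im := by simp
      -- On the circle `r² = (w - x) * conj (w - x)`, so a factor `w - x` splits off.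
      have hfac : ‖(w - x) ^ 2 - (r : ℂ) ^ 2‖ = 2 * |w.im| * r := by
        have h1 : (w - x) ^ 2 - (r : ℂ) ^ 2 = 2 * Complex.I * ((w.im : ℝ) : ℂ) * (w - x) := by
          have hsq : (r : ℂ) ^ 2 = (w - x) * (starRingEnd ℂ) (w - x) := by
            rw [Complex.mul_conj, Complex.normSq_eq_norm_sq, hw]; push_cast; ring
          have hc2 : (w - x) - (starRingEnd ℂ) (w - x) = 2 * Complex.I * ((w.im : ℝ) : ℂ) := by
            rw [Complex.sub_conj, him]; push_cast; ring
          rw [hsq, ← hc2]; ring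
        rw [h1]; simp [hw]
      have hwM : M < ‖w‖ := hball (Metric.mem_closedBall.2 (by rw [dist_eq_norm]; exact hw.le))
      rw [hg]
      simp only [norm_smul, norm_pow, hfac]
      rcases eq_or_ne w.im 0 with h0 | h0
      · rw [h0]; simp; positivity
      have hp : 0 < |w.im| := abs_pos.2 h0
      have hw3 : ‖w‖ ≤ 3 * r := by
        calc ‖w‖ = ‖(w - x) + x‖ := by congr 1; ring
          _ ≤ ‖w - x‖ + ‖(x : ℂ)‖ := norm_add_le _ _
          _ = _ := by rw [hw, hxn]; ring
      calc (2 * |w.im| * r) ^ (n + 1) * ‖resolventOf H w‖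
          ≤ (2 * |w.im| * r) ^ (n + 1) * (c * |w.im|⁻¹ * (2 * (3 * r) / |w.im|) ^ n) := by
            have := hres' w (by linarith) h0
            refine mul_le_mul_of_nonneg_left (this.trans ?_) (by positivity)
            gcongr
        _ = _ := by
            have hne := hp.ne'
            rw [show 2 * (3 * r) = 6 * r by ring, div_pow, mul_pow, mul_pow, mul_pow,
              pow_succ |w.im|]
            field_simp
            ring
    have hmax := Complex.norm_le_of_forall_mem_frontier_norm_le Metric.isBounded_ball hd hbound
      (z := z) (subset_closure (by
        rw [Metric.mem_ball, dist_eq_norm]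
        have : z - x = z.im * Complex.I := by
          rw [sub_eq_iff_eq_add, add_comm]; exact (Complex.re_add_im z).symm
        rw [this]; simpa using himr))
    have hfacz : r ^ 2 ≤ ‖(z - x) ^ 2 - (r : ℂ) ^ 2‖ := by
      have : (z - x) ^ 2 - (r : ℂ) ^ 2 = ((-(z.im ^ 2 + r ^ 2) : ℝ) : ℂ) := by
        have : z - x = z.im * Complex.I := by
          rw [sub_eq_iff_eq_add, add_comm]; exact (Complex.re_add_im z).symm
        rw [this, mul_pow, Complex.I_sq]; push_cast; ring
      rw [this, Complex.norm_real, Real.norm_eq_abs, abs_neg]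
      exact le_trans (by nlinarith [sq_nonneg z.im]) (le_abs_self _)
    have h1 : r ^ (2 * n + 1) * (r * ‖resolventOf H z‖)
        ≤ r ^ (2 * n + 1) * (c * 2 ^ (n + 1) * 6 ^ n) := by
      calc r ^ (2 * n + 1) * (r * ‖resolventOf H z‖)
          = (r ^ 2) ^ (n + 1) * ‖resolventOf H z‖ := by
            rw [← pow_mul, ← mul_assoc, ← pow_succ]; rfl
        _ ≤ ‖(z - x) ^ 2 - (r : ℂ) ^ 2‖ ^ (n + 1) * ‖resolventOf H z‖ := by gcongr
        _ = ‖g z‖ := by simp only [hg, norm_smul, norm_pow]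
        _ ≤ _ := hmax
        _ = _ := by ring
    have h2 := le_of_mul_le_mul_left h1 (by positivity)
    rw [le_div_iff₀ hz0]
    refine le_trans ?_ (le_max_right _ _)
    calc ‖resolventOf H z‖ * ‖z‖ ≤ ‖resolventOf H z‖ * (3 * r) := by gcongr
      _ = 3 * (r * ‖resolventOf H z‖) := by ring
      _ ≤ 3 * (c * 2 ^ (n + 1) * 6 ^ n) := by gcongr
      _ = _ := by ring

/-- If the spectrum is bounded, then `z R(z)` extends holomorphically to infinity; on the domain
of `H` its value there is the identity, so it is the identity, and `R(z)` is invertible for large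
`z`. -/
theorem exists_isUnit_resolventOf [CompleteSpace B] (hdense : Dense (H.domain : Set B))
    {M c α : ℝ} {n : ℕ} (hM : 1 ≤ M) (hc : 0 ≤ c) (hα : α ≤ n)
    (hU : {z : ℂ | M < ‖z‖} ⊆ resolventSetOf H)
    (hres : ∀ z : ℂ, z.im ≠ 0 →
      ‖resolventOf H z‖ ≤ c * |z.im|⁻¹ * (bracket z / |z.im|) ^ α) :
    ∃ z ∈ resolventSetOf H, IsUnit (resolventOf H z) := by
  obtain ⟨C, hC⟩ := exists_norm_resolventOf_le_div hM hc hα hU hres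
  set S : ℂ → (B →L[ℂ] B) := fun w => w⁻¹ • resolventOf H w⁻¹ with hS
  have hsmall : ∀ᶠ w : ℂ in 𝓝[≠] 0, w ≠ 0 ∧ 4 * M < ‖w⁻¹‖ := by
    have h1 : Tendsto (fun w : ℂ => ‖w⁻¹‖) (𝓝[≠] 0) atTop :=
      tendsto_norm_cobounded_atTop.comp tendsto_inv₀_nhdsNE_zero
    filter_upwards [self_mem_nhdsWithin, h1.eventually_gt_atTop (4 * M)] with w hw hw2
    exact ⟨hw, hw2⟩
  have hopen : IsOpen {z : ℂ | M < ‖z‖} := isOpen_lt continuous_const continuous_norm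
  have hdR := differentiableOn_resolventOf hopen hU
  have hd : ∀ᶠ w in 𝓝[≠] 0, DifferentiableAt ℂ S w := by
    filter_upwards [hsmall] with w ⟨hw, hw2⟩
    have hw3 : M < ‖w⁻¹‖ := by linarith
    have hR : DifferentiableAt ℂ (fun w => resolventOf H w⁻¹) w :=
      DifferentiableAt.fun_comp' w ((hdR _ hw3).differentiableAt (hopen.mem_nhds hw3))
        (differentiableAt_inv hw)
    exact (differentiableAt_inv hw).smul hR
  have hb : IsBoundedUnder (· ≤ ·) (𝓝[≠] 0) fun w => ‖S w - S 0‖ := by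
    refine isBoundedUnder_of_eventually_le (a := C) ?_
    filter_upwards [hsmall] with w ⟨hw, hw2⟩
    have hpos : 0 < ‖w⁻¹‖ := by linarith
    have := hC _ hw2
    rw [le_div_iff₀ hpos] at this
    simp only [hS, inv_zero, zero_smul, sub_zero, norm_smul]
    linarith
  have hlim := Complex.tendsto_limUnder_of_differentiable_on_punctured_nhds_of_bounded_under hd hb
  set T := limUnder (𝓝[≠] (0 : ℂ)) S
  have hT : T = 1 := by
    refine ContinuousLinearMap.ext fun v => ?_
    refine congrFun (Continuous.ext_on hdense T.continuous
      (ContinuousLinearMap.continuous (1 : B →L[ℂ] B)) fun u hu => ?_) v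
    have h1 : Tendsto (fun w => S w u) (𝓝[≠] 0) (𝓝 (T u)) :=
      ((ContinuousLinearMap.apply ℂ B u).continuous.tendsto T).comp hlim
    have h2 : Tendsto (fun w => S w u) (𝓝[≠] 0) (𝓝 u) := by
      rw [tendsto_iff_norm_sub_tendsto_zero]
      have h0 : Tendsto (fun w : ℂ => C * ‖w‖ * ‖H ⟨u, hu⟩‖) (𝓝[≠] 0) (𝓝 0) := by
        refine tendsto_nhdsWithin_of_tendsto_nhds ?_
        have : Continuous fun w : ℂ => C * ‖w‖ * ‖H ⟨u, hu⟩‖ := by fun_prop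
        simpa using this.tendsto 0
      refine squeeze_zero' (Eventually.of_forall fun _ => norm_nonneg _) ?_ h0
      filter_upwards [hsmall] with w ⟨hw, hw2⟩
      have hw3 : M < ‖w⁻¹‖ := by linarith
      have e := (resolventOf_spec (hU hw3)).2 ⟨u, hu⟩
      simp only [map_sub, map_smul] at e
      have e2 : S w u - u = resolventOf H w⁻¹ (H ⟨u, hu⟩) := by
        simp only [hS, smul_apply]
        rw [sub_eq_iff_eq_add, add_comm]; exact sub_eq_iff_eq_add.1 e
      rw [e2]
      refine (ContinuousLinearMap.le_opNorm _ _).trans ?_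
      gcongr
      refine (hC _ hw2).trans_eq ?_
      rw [norm_inv, div_inv_eq_mul]
    exact tendsto_nhds_unique h1 h2
  rw [hT] at hlim
  have hunit : ∀ᶠ w in 𝓝[≠] 0, IsUnit (S w) :=
    hlim.eventually (Units.isOpen.mem_nhds isUnit_one)
  obtain ⟨w, hw, hw0, hw2⟩ := (hunit.and hsmall).exists
  refine ⟨w⁻¹, hU (show M < ‖w⁻¹‖ by linarith), ?_⟩
  have : resolventOf H w⁻¹ = algebraMap ℂ (B →L[ℂ] B) w * S w := by
    rw [hS, ← Algebra.smul_def, smul_smul, mul_inv_cancel₀ hw0, one_smul]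
  rw [this]
  exact ((IsUnit.mk0 w hw0).map _).mul hw

end Resolvent

/-! ### The Cauchy–Pompeiu formula -/

theorem dbar_eq_fderiv {F : ℝ → ℝ → ℂ} {x y : ℝ}
    (hF : DifferentiableAt ℝ (fun p : ℝ × ℝ => F p.1 p.2) (x, y)) :
    dbar F x y = (1 / 2 : ℂ) * (fderiv ℝ (fun p : ℝ × ℝ => F p.1 p.2) (x, y) (1, 0)
      + Complex.I * fderiv ℝ (fun p : ℝ × ℝ => F p.1 p.2) (x, y) (0, 1)) := by
  have h1 : HasDerivAt (fun t : ℝ => F t y)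
      (fderiv ℝ (fun p : ℝ × ℝ => F p.1 p.2) (x, y) (1, 0)) x :=
    hF.hasFDerivAt.comp_hasDerivAt (f := fun t : ℝ => (t, y)) x
      ((hasDerivAt_id x).prodMk (hasDerivAt_const x y))
  have h2 : HasDerivAt (fun t : ℝ => F x t)
      (fderiv ℝ (fun p : ℝ × ℝ => F p.1 p.2) (x, y) (0, 1)) y :=
    hF.hasFDerivAt.comp_hasDerivAt (f := fun t : ℝ => (x, t)) y
      ((hasDerivAt_const y x).prodMk (hasDerivAt_id y))
  rw [dbar, h1.deriv, h2.deriv]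

theorem continuous_dbar {F : ℝ → ℝ → ℂ} (hF : ContDiff ℝ 1 (fun p : ℝ × ℝ => F p.1 p.2)) :
    Continuous fun p : ℝ × ℝ => dbar F p.1 p.2 := by
  have hD := hF.continuous_fderiv one_ne_zero
  have : (fun p : ℝ × ℝ => dbar F p.1 p.2) = fun p =>
      (1 / 2 : ℂ) * (fderiv ℝ (fun p : ℝ × ℝ => F p.1 p.2) p (1, 0)
      + Complex.I * fderiv ℝ (fun p : ℝ × ℝ => F p.1 p.2) p (0, 1)) := by
    funext p
    exact dbar_eq_fderiv (hF.differentiable one_ne_zero p)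
  rw [this]
  fun_prop

theorem continuous_dbar_re_im {F : ℝ → ℝ → ℂ}
    (hF : ContDiff ℝ 1 (fun p : ℝ × ℝ => F p.1 p.2)) :
    Continuous fun z : ℂ => dbar F z.re z.im :=
  (continuous_dbar hF).comp (Complex.continuous_re.prodMk Complex.continuous_im)

/-- The derivative in the radius of the integral of a `C¹` function over the circle of radius `r`
about `p`. -/
theorem hasDerivAt_integral_circle {Φ : ℝ × ℝ → ℂ} (hΦ : ContDiff ℝ 1 Φ) (p : ℝ × ℝ) (r₀ : ℝ) :
    HasDerivAt
      (fun r => ∫ θ in (-Real.pi)..Real.pi, Φ (p + r • (Real.cos θ, Real.sin θ)))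
      (∫ θ in (-Real.pi)..Real.pi,
        fderiv ℝ Φ (p + r₀ • (Real.cos θ, Real.sin θ)) (Real.cos θ, Real.sin θ)) r₀ := by
  have hD := hΦ.continuous_fderiv one_ne_zero
  have hG : Continuous fun q : ℝ × ℝ => fderiv ℝ Φ
      (p + q.1 • (Real.cos q.2, Real.sin q.2)) (Real.cos q.2, Real.sin q.2) := by fun_prop
  have hcomp : IsCompact (Metric.closedBall r₀ 1 ×ˢ Set.uIcc (-Real.pi) Real.pi) :=
    (isCompact_closedBall r₀ 1).prod isCompact_uIcc
  obtain ⟨C, hC⟩ := hcomp.exists_bound_of_continuousOn hG.continuousOn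
  have hcont : ∀ r : ℝ, Continuous fun θ : ℝ => Φ (p + r • (Real.cos θ, Real.sin θ)) := by
    intro r
    have := hΦ.continuous
    fun_prop
  refine (intervalIntegral.hasDerivAt_integral_of_dominated_loc_of_deriv_le
    (F' := fun r θ => fderiv ℝ Φ (p + r • (Real.cos θ, Real.sin θ)) (Real.cos θ, Real.sin θ))
    (bound := fun _ => C)
    (Metric.closedBall_mem_nhds r₀ one_pos) ?_ ?_ ?_ ?_ ?_ ?_).2
  · exact Eventually.of_forall fun r => (hcont r).aestronglyMeasurable
  · exact (hcont r₀).intervalIntegrable _ _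
  · exact (hG.comp (Continuous.prodMk_right r₀)).aestronglyMeasurable
  · exact Eventually.of_forall fun θ hθ r hr =>
      hC (r, θ) ⟨hr, Set.uIoc_subset_uIcc hθ⟩
  · exact intervalIntegrable_const
  · refine Eventually.of_forall fun θ _ r _ => ?_
    refine (hΦ.differentiable one_ne_zero _).hasFDerivAt.comp_hasDerivAt
      (f := fun r : ℝ => p + r • (Real.cos θ, Real.sin θ)) r ?_
    simpa using ((hasDerivAt_id r).smul_const (Real.cos θ, Real.sin θ)).const_add p

theorem integral_circle_fderiv_tangent {Φ : ℝ × ℝ → ℂ} (hΦ : ContDiff ℝ 1 Φ) (p : ℝ × ℝ)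
    {r : ℝ} (hr : r ≠ 0) :
    ∫ θ in (-Real.pi)..Real.pi,
      fderiv ℝ Φ (p + r • (Real.cos θ, Real.sin θ)) (-Real.sin θ, Real.cos θ) = 0 := by
  have hD := hΦ.continuous_fderiv one_ne_zero
  have hG : Continuous fun θ : ℝ => fderiv ℝ Φ
      (p + r • (Real.cos θ, Real.sin θ)) (-Real.sin θ, Real.cos θ) := by fun_prop
  have hd : ∀ θ : ℝ, HasDerivAt (fun θ : ℝ => Φ (p + r • (Real.cos θ, Real.sin θ)))
      (r • fderiv ℝ Φ (p + r • (Real.cos θ, Real.sin θ)) (-Real.sin θ, Real.cos θ)) θ := by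
    intro θ
    rw [← map_smul]
    refine (hΦ.differentiable one_ne_zero _).hasFDerivAt.comp_hasDerivAt
      (f := fun θ : ℝ => p + r • (Real.cos θ, Real.sin θ)) θ ?_
    exact (((Real.hasDerivAt_cos θ).prodMk (Real.hasDerivAt_sin θ)).const_smul r).const_add p
  have h := intervalIntegral.integral_eq_sub_of_hasDerivAt (a := -Real.pi) (b := Real.pi)
    (fun θ _ => hd θ) ((hG.const_smul r).intervalIntegrable _ _)
  rw [intervalIntegral.integral_smul] at h
  have h0 : r • (∫ θ in (-Real.pi)..Real.pi,
      fderiv ℝ Φ (p + r • (Real.cos θ, Real.sin θ)) (-Real.sin θ, Real.cos θ)) = 0 := by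
    rw [h]; simp
  exact (smul_eq_zero.1 h0).resolve_left hr

theorem integrableOn_comp_polarCoord_symm {E : Type*} [NormedAddCommGroup E]
    [NormedSpace ℝ E] {f : ℂ → E} (hm : StronglyMeasurable f) (hf : Integrable f) :
    IntegrableOn (fun p : ℝ × ℝ => p.1 • f (Complex.polarCoord.symm p)) polarCoord.target := by
  have hcont : Measurable (Complex.polarCoord.symm : ℝ × ℝ → ℂ) := by
    have : (Complex.polarCoord.symm : ℝ × ℝ → ℂ)
        = fun p : ℝ × ℝ => (p.1 : ℂ) * (Real.cos p.2 + Real.sin p.2 * Complex.I) := by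
      funext p; exact Complex.polarCoord_symm_apply p
    rw [this]; fun_prop
  refine ⟨(measurable_fst.stronglyMeasurable.smul
    (hm.comp_measurable hcont)).aestronglyMeasurable, ?_⟩
  have h := Complex.lintegral_comp_polarCoord_symm fun z => ‖f z‖ₑ
  refine lt_of_le_of_lt (le_of_eq ?_) (h.trans_lt hf.2)
  refine setLIntegral_congr_fun polarCoord.open_target.measurableSet fun p hp => ?_
  have hp0 : 0 < p.1 := hp.1
  rw [enorm_smul, smul_eq_mul, Real.enorm_eq_ofReal hp0.le]

/-- The **Cauchy–Pompeiu formula** for a `C¹` function on the plane that vanishes at infinity: in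
polar coordinates about `μ` the integrand is half the radial derivative of the function plus an
angular derivative, and the latter has mean zero on each circle. -/
theorem integral_dbar_smul_inv {F : ℝ → ℝ → ℂ} (hF : ContDiff ℝ 1 (fun p : ℝ × ℝ => F p.1 p.2))
    (hlim : Tendsto (fun z : ℂ => F z.re z.im) (Bornology.cobounded ℂ) (𝓝 0)) (μ : ℂ)
    (hint : Integrable (fun z : ℂ => dbar F z.re z.im • (z - μ)⁻¹) volume) :
    ∫ z : ℂ, dbar F z.re z.im • (z - μ)⁻¹ = -Real.pi * F μ.re μ.im := by
  set Φ : ℝ × ℝ → ℂ := fun p => F p.1 p.2 with hΦ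
  set p₀ : ℝ × ℝ := (μ.re, μ.im) with hp₀
  set h : ℂ → ℂ := fun z => dbar F (z + μ).re (z + μ).im • z⁻¹ with hh
  have hD := hF.continuous_fderiv one_ne_zero
  have hint' : Integrable h volume := by
    simpa [hh] using hint.comp_add_right μ
  have hmeas : StronglyMeasurable h := by
    have hc : Measurable fun z : ℂ => dbar F (z + μ).re (z + μ).im :=
      ((continuous_dbar_re_im hF).comp (continuous_add_const μ)).measurable
    exact (hc.smul measurable_inv).stronglyMeasurable
  have hpol := integrableOn_comp_polarCoord_symm hmeas hint'
  set M : ℝ → ℂ := fun r =>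
    ∫ θ in (-Real.pi)..Real.pi, Φ (p₀ + r • (Real.cos θ, Real.sin θ)) with hM
  set M' : ℝ → ℂ := fun r => ∫ θ in (-Real.pi)..Real.pi,
    fderiv ℝ Φ (p₀ + r • (Real.cos θ, Real.sin θ)) (Real.cos θ, Real.sin θ) with hM'
  -- `∂/∂z̄ = (e^{iθ} / 2) (∂/∂r + (i / r) ∂/∂θ)`, and the factor `r e^{iθ}` is cancelled by the
  -- Jacobian and by the Cauchy kernel.
  have hpoint : ∀ r θ : ℝ, 0 < r → r • h (Complex.polarCoord.symm (r, θ))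
      = (1 / 2 : ℂ) * (fderiv ℝ Φ (p₀ + r • (Real.cos θ, Real.sin θ)) (Real.cos θ, Real.sin θ)
        + Complex.I * fderiv ℝ Φ (p₀ + r • (Real.cos θ, Real.sin θ))
          (-Real.sin θ, Real.cos θ)) := by
    intro r θ hr
    have hz : Complex.polarCoord.symm (r, θ) = r * Complex.exp (θ * Complex.I) := by
      rw [Complex.polarCoord_symm_apply, Complex.exp_mul_I]; push_cast; rfl
    have hre : (Complex.polarCoord.symm (r, θ) + μ).re = μ.re + r * Real.cos θ := by
      rw [hz, Complex.add_re, Complex.re_ofReal_mul, Complex.exp_ofReal_mul_I_re, add_comm]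
    have him : (Complex.polarCoord.symm (r, θ) + μ).im = μ.im + r * Real.sin θ := by
      rw [hz, Complex.add_im, Complex.im_ofReal_mul, Complex.exp_ofReal_mul_I_im, add_comm]
    have hlin : ∀ (L : ℝ × ℝ →L[ℝ] ℂ) (a b : ℝ), L (a, b) = a * L (1, 0) + b * L (0, 1) := by
      intro L a b
      have : ((a, b) : ℝ × ℝ) = a • (1, 0) + b • (0, 1) := by simp
      rw [this, map_add, map_smul, map_smul, Complex.real_smul, Complex.real_smul]
    have hp : p₀ + r • (Real.cos θ, Real.sin θ)
        = (μ.re + r * Real.cos θ, μ.im + r * Real.sin θ) := rfl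
    simp only [hh]
    rw [hre, him, dbar_eq_fderiv (hF.differentiable one_ne_zero _), hp,
      hlin _ (Real.cos θ), hlin _ (-Real.sin θ), hz, mul_inv, ← Complex.exp_neg,
      show -((θ : ℂ) * Complex.I) = ((-θ : ℝ) : ℂ) * Complex.I by push_cast; ring,
      Complex.exp_mul_I, Complex.real_smul, smul_eq_mul, ← Complex.ofReal_cos,
      ← Complex.ofReal_sin, Real.cos_neg, Real.sin_neg]
    have hr' : (r : ℂ) ≠ 0 := by exact_mod_cast hr.ne'
    push_cast
    field_simp
    linear_combination (-(Complex.sin θ)) * fderiv ℝ Φ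
      (μ.re + r * Real.cos θ, μ.im + r * Real.sin θ) (0, 1) * Complex.I_sq
  have hcirc : ∀ r : ℝ, 0 < r →
      ∫ θ in Set.Ioo (-Real.pi) Real.pi, r • h (Complex.polarCoord.symm (r, θ))
        = (1 / 2 : ℂ) * M' r := by
    intro r hr
    simp_rw [hpoint r _ hr]
    have hc1 : Continuous fun θ : ℝ => fderiv ℝ Φ
      (p₀ + r • (Real.cos θ, Real.sin θ)) (Real.cos θ, Real.sin θ) := by fun_prop
    have hc2 : Continuous fun θ : ℝ => Complex.I * fderiv ℝ Φ
      (p₀ + r • (Real.cos θ, Real.sin θ)) (-Real.sin θ, Real.cos θ) := by fun_prop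
    rw [← integral_Ioc_eq_integral_Ioo,
      ← intervalIntegral.integral_of_le (by linarith [Real.pi_pos]),
      intervalIntegral.integral_const_mul,
      intervalIntegral.integral_add (hc1.intervalIntegrable _ _) (hc2.intervalIntegrable _ _),
      intervalIntegral.integral_const_mul, integral_circle_fderiv_tangent hF p₀ hr.ne',
      mul_zero, add_zero]
  have htarget : (volume.restrict polarCoord.target : Measure (ℝ × ℝ))
      = (volume.restrict (Set.Ioi 0)).prod (volume.restrict (Set.Ioo (-Real.pi) Real.pi)) := by
    rw [Measure.prod_restrict]; rfl
  have hM'int : IntegrableOn (fun r => (1 / 2 : ℂ) * M' r) (Set.Ioi 0) := by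
    have h1 : Integrable (fun p : ℝ × ℝ => p.1 • h (Complex.polarCoord.symm p))
        ((volume.restrict (Set.Ioi (0 : ℝ))).prod
        (volume.restrict (Set.Ioo (-Real.pi) Real.pi))) := by
      rw [← htarget]; exact hpol
    refine IntegrableOn.congr_fun h1.integral_prod_left (fun r hr => hcirc r hr)
      measurableSet_Ioi
  have hlimM : Tendsto M atTop (𝓝 0) := by
    rw [Metric.tendsto_atTop]
    intro ε hε
    have hε' : 0 < ε / (4 * Real.pi) := by have := Real.pi_pos; positivity
    have hev := (Metric.tendsto_nhds.1 hlim) _ hε'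
    obtain ⟨R, -, hR⟩ := (Metric.hasBasis_cobounded_compl_closedBall (0 : ℂ)).eventually_iff.1 hev
    refine ⟨|R| + ‖μ‖ + 1, fun r hr => ?_⟩
    have hr0 : 0 < r := by linarith [abs_nonneg R, norm_nonneg μ]
    have hb : ‖M r‖ ≤ ε / (4 * Real.pi) * |Real.pi - (-Real.pi)| := by
      refine intervalIntegral.norm_integral_le_of_norm_le_const fun θ _ => ?_
      set z : ℂ := μ + r * Complex.exp (θ * Complex.I) with hz
      have hzre : z.re = μ.re + r * Real.cos θ := by
        rw [hz, Complex.add_re, Complex.re_ofReal_mul, Complex.exp_ofReal_mul_I_re]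
      have hzim : z.im = μ.im + r * Real.sin θ := by
        rw [hz, Complex.add_im, Complex.im_ofReal_mul, Complex.exp_ofReal_mul_I_im]
      have hzn : r ≤ ‖z‖ + ‖μ‖ := by
        calc r = ‖z - μ‖ := by
              rw [hz, add_sub_cancel_left, norm_mul, Complex.norm_exp_ofReal_mul_I, mul_one,
                Complex.norm_real, Real.norm_eq_abs, abs_of_pos hr0]
          _ ≤ _ := norm_sub_le _ _
      have := hR (x := z) (by
        simp only [Set.mem_compl_iff, Metric.mem_closedBall, dist_zero_right, not_le]
        linarith [le_abs_self R])
      rw [dist_zero_right, hzre, hzim] at this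
      exact this.le
    rw [dist_zero_right]
    refine hb.trans_lt ?_
    have hpi := Real.pi_pos
    rw [sub_neg_eq_add, abs_of_pos (by positivity)]
    have : ε / (4 * Real.pi) * (Real.pi + Real.pi) = ε / 2 := by field_simp; ring
    linarith
  have hM0 : M 0 = 2 * Real.pi * F μ.re μ.im := by
    simp only [hM, zero_smul, add_zero, intervalIntegral.integral_const, hΦ, hp₀,
      Complex.real_smul]
    push_cast; ring
  calc ∫ z : ℂ, dbar F z.re z.im • (z - μ)⁻¹ = ∫ z : ℂ, h z := by
        rw [← integral_add_right_eq_self _ μ]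
        simp [hh]
    _ = ∫ p in polarCoord.target, p.1 • h (Complex.polarCoord.symm p) :=
        (Complex.integral_comp_polarCoord_symm h).symm
    _ = ∫ r in Set.Ioi 0, ∫ θ in Set.Ioo (-Real.pi) Real.pi,
          r • h (Complex.polarCoord.symm (r, θ)) := by
        unfold IntegrableOn at hpol
        rw [htarget] at hpol ⊢
        exact integral_prod _ hpol
    _ = ∫ r in Set.Ioi 0, (1 / 2 : ℂ) * M' r :=
        setIntegral_congr_fun measurableSet_Ioi fun r hr => hcirc r hr
    _ = 0 - (1 / 2 : ℂ) * M 0 :=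
        integral_Ioi_of_hasDerivAt_of_tendsto'
          (fun r _ => (hasDerivAt_integral_circle hF p₀ r).const_mul _) hM'int
          (by rw [← mul_zero (1 / 2 : ℂ)]; exact hlimM.const_mul _)
    _ = _ := by rw [hM0]; ring

/-! ### Almost analytic extensions -/

theorem contDiff_iteratedDeriv {f : ℝ → ℂ} (hf : ContDiff ℝ ∞ f) (r : ℕ) :
    ContDiff ℝ ∞ (iteratedDeriv r f) := by
  rw [iteratedDeriv_eq_iterate]
  exact ContDiff.iterate_deriv r hf

/-- The Taylor polynomial `∑_{r ≤ n} f^{(r)}(x) (i y)^r / r!` of the almost analytic extension,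
without the cut-off. -/
noncomputable def formalTaylor (n : ℕ) (f : ℝ → ℂ) (x y : ℝ) : ℂ :=
  ∑ r ∈ Finset.range (n + 1),
    iteratedDeriv r f x * (Complex.I * (y : ℂ)) ^ r / (r.factorial : ℂ)

theorem contDiff_formalTaylor {f : ℝ → ℂ} (hf : ContDiff ℝ ∞ f) (n : ℕ) :
    ContDiff ℝ ∞ (fun p : ℝ × ℝ => formalTaylor n f p.1 p.2) := by
  unfold formalTaylor
  refine ContDiff.sum fun r _ => ?_
  have h1 : ContDiff ℝ ∞ (fun p : ℝ × ℝ => iteratedDeriv r f p.1) :=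
    (contDiff_iteratedDeriv hf r).comp contDiff_fst
  have h2 : ContDiff ℝ ∞ (fun p : ℝ × ℝ => (p.2 : ℂ)) :=
    Complex.ofRealCLM.contDiff.comp contDiff_snd
  exact (h1.mul ((contDiff_const.mul h2).pow r)).div_const _

theorem contDiff_almostAnalytic {f : ℝ → ℂ} (hf : ContDiff ℝ ∞ f) {τ : ℝ → ℝ → ℝ}
    (hτ : IsCutoff τ) (n : ℕ) :
    ContDiff ℝ ∞ (fun p : ℝ × ℝ => almostAnalytic n τ f p.1 p.2) :=
  (contDiff_formalTaylor hf n).mul (Complex.ofRealCLM.contDiff.comp hτ.smooth)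

/-- Under `2 ∂/∂z̄ = ∂/∂x + i ∂/∂y` the Taylor polynomial telescopes to the single term
`f^{(n + 1)}(x) (i y)^n / n!`. -/
theorem exists_hasDerivAt_formalTaylor {f : ℝ → ℂ} (hf : ContDiff ℝ ∞ f) (n : ℕ) (x y : ℝ) :
    ∃ a b : ℂ, HasDerivAt (fun t : ℝ => formalTaylor n f t y) a x ∧
      HasDerivAt (fun t : ℝ => formalTaylor n f x t) b y ∧
      a + Complex.I * b
        = iteratedDeriv (n + 1) f x * (Complex.I * (y : ℂ)) ^ n / (n.factorial : ℂ) := by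
  have hD : ∀ r, HasDerivAt (iteratedDeriv r f) (iteratedDeriv (r + 1) f x) x := by
    intro r
    have := ((contDiff_iteratedDeriv hf r).differentiable (by simp)) x
    rw [iteratedDeriv_succ]
    exact this.hasDerivAt
  have hI : HasDerivAt (fun t : ℝ => Complex.I * (t : ℂ)) Complex.I y := by
    simpa using (HasDerivAt.ofReal_comp (hasDerivAt_id y)).const_mul Complex.I
  induction n with
  | zero =>
    refine ⟨iteratedDeriv 1 f x, 0, ?_, ?_, ?_⟩
    · simpa [formalTaylor] using hD 0
    · simpa [formalTaylor] using hasDerivAt_const y (f x)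
    · simp
  | succ n ih =>
    obtain ⟨a, b, ha, hb, hab⟩ := ih
    have hx := ((hD (n + 1)).mul_const ((Complex.I * (y : ℂ)) ^ (n + 1))).div_const
      ((n + 1).factorial : ℂ)
    have hy := ((hI.pow (n + 1)).const_mul (iteratedDeriv (n + 1) f x)).div_const
      ((n + 1).factorial : ℂ)
    have hsx : (fun t : ℝ => formalTaylor (n + 1) f t y) = fun t => formalTaylor n f t y
        + iteratedDeriv (n + 1) f t * (Complex.I * (y : ℂ)) ^ (n + 1) / ((n + 1).factorial : ℂ) := by
      funext t; exact Finset.sum_range_succ _ _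
    have hsy : (fun t : ℝ => formalTaylor (n + 1) f x t) = fun t => formalTaylor n f x t
        + iteratedDeriv (n + 1) f x * (Complex.I * (t : ℂ)) ^ (n + 1) / ((n + 1).factorial : ℂ) := by
      funext t; exact Finset.sum_range_succ _ _
    refine ⟨_, _, by rw [hsx]; exact ha.add hx, by rw [hsy]; exact hb.add hy, ?_⟩
    have hn : (n.factorial : ℂ) ≠ 0 := by exact_mod_cast n.factorial_ne_zero
    have hn1 : ((n : ℂ) + 1) ≠ 0 := by exact_mod_cast n.succ_ne_zero
    rw [eq_sub_of_add_eq hab, Nat.factorial_succ, Nat.add_sub_cancel]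
    push_cast
    field_simp
    linear_combination (n + 1 : ℂ) * iteratedDeriv (n + 1) f x * (Complex.I * (y : ℂ)) ^ n * Complex.I_sq

theorem continuous_bracket : Continuous fun x : ℝ => bracket x := by
  unfold bracket; fun_prop

theorem bracket_sq (z : ℝ) : bracket z ^ 2 = 1 + z ^ 2 := by
  rw [bracket, Real.sq_sqrt (by positivity), Real.norm_eq_abs, sq_abs]

theorem norm_cutoff_le {τ : ℝ → ℝ → ℝ} (hτ : IsCutoff τ) {K : ℝ}
    (hK : ∀ x y : ℝ, |deriv (fun t : ℝ => τ x t) y| ≤ K / bracket x) (x y : ℝ)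
    (hy : |y| ≤ 2 * bracket x) : |τ x y| ≤ 1 + 2 * K := by
  have hd : ∀ t ∈ (Set.univ : Set ℝ), DifferentiableAt ℝ (fun t => τ x t) t := fun t _ =>
    ((hτ.smooth.comp (contDiff_prodMk_right x)).differentiable (by simp)) t
  have h := convex_univ.norm_image_sub_le_of_norm_deriv_le hd (fun t _ => hK x t)
    (Set.mem_univ 0) (Set.mem_univ y)
  have hb := bracket_pos x
  have hK0 : 0 ≤ K / bracket x := (abs_nonneg _).trans (hK x 0)
  rw [hτ.eq_one x 0 (by simpa using hb.le), Real.norm_eq_abs, Real.norm_eq_abs, sub_zero] at h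
  have h2 : K / bracket x * |y| ≤ 2 * K := by
    calc K / bracket x * |y| ≤ K / bracket x * (2 * bracket x) := by gcongr
      _ = _ := by field_simp
  have h3 : |τ x y| ≤ |τ x y - 1| + 1 := by
    simpa using abs_add_le (τ x y - 1) 1
  linarith

theorem exists_norm_formalTaylor_le {β : ℝ} {f : ℝ → ℂ} (hf : f ∈ symbolClass β) (n : ℕ) :
    ∃ C : ℝ, 0 ≤ C ∧ ∀ x y : ℝ, |y| ≤ 2 * bracket x →
      ‖formalTaylor n f x y‖ ≤ C * bracket x ^ β := by
  choose c hc hcb using hf.2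
  refine ⟨∑ r ∈ Finset.range (n + 1), c r * 2 ^ r,
    Finset.sum_nonneg fun r _ => by have := hc r; positivity, fun x y hy => ?_⟩
  have hb := bracket_pos x
  rw [Finset.sum_mul]
  refine (norm_sum_le _ _).trans (Finset.sum_le_sum fun r _ => ?_)
  have hfac : (1 : ℝ) ≤ (r.factorial : ℝ) := by exact_mod_cast r.factorial_pos
  rw [norm_div, norm_mul, norm_pow, norm_mul, Complex.norm_I, one_mul, Complex.norm_real,
    Complex.norm_natCast, Real.norm_eq_abs]
  have hcr := hc r
  calc ‖iteratedDeriv r f x‖ * |y| ^ r / (r.factorial : ℝ)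
      ≤ ‖iteratedDeriv r f x‖ * |y| ^ r := div_le_self (by positivity) hfac
    _ ≤ (c r * bracket x ^ (β - (r : ℝ))) * (2 * bracket x) ^ r := by
        have := hcb r x
        gcongr
    _ = c r * 2 ^ r * (bracket x ^ (β - (r : ℝ)) * bracket x ^ (r : ℝ)) := by
        rw [mul_pow, Real.rpow_natCast]; ring
    _ = _ := by rw [← Real.rpow_add hb, sub_add_cancel]

/-- The almost analytic extension decays like `|z|^β` at infinity, since `|z|` is comparable to
`⟨x⟩` on the support of the cut-off. -/
theorem tendsto_almostAnalytic_cobounded {β : ℝ} (hβ : β < 0) {f : ℝ → ℂ}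
    (hf : f ∈ symbolClass β) {τ : ℝ → ℝ → ℝ} (hτ : IsCutoff τ) (n : ℕ) :
    Tendsto (fun z : ℂ => almostAnalytic n τ f z.re z.im) (Bornology.cobounded ℂ) (𝓝 0) := by
  obtain ⟨C, hC, hCb⟩ := exists_norm_formalTaylor_le hf n
  obtain ⟨K, hK⟩ := hτ.deriv_bound
  have hlim : Tendsto (fun z : ℂ => C * (1 + 2 * |K|) * (‖z‖ / 3) ^ β) (Bornology.cobounded ℂ)
      (𝓝 0) := by
    have h1 : Tendsto (fun z : ℂ => ‖z‖ / 3) (Bornology.cobounded ℂ) atTop :=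
      tendsto_norm_cobounded_atTop.atTop_div_const (by norm_num)
    have h2 := (tendsto_rpow_neg_atTop (neg_pos.2 hβ)).comp h1
    simpa using h2.const_mul (C * (1 + 2 * |K|))
  refine squeeze_zero_norm' ?_ hlim
  filter_upwards [tendsto_norm_cobounded_atTop.eventually_gt_atTop (0 : ℝ)] with z hz
  have hb := bracket_pos z.re
  by_cases h : 2 * bracket z.re ≤ |z.im|
  · rw [almostAnalytic, hτ.eq_zero _ _ h]
    simp only [Complex.ofReal_zero, mul_zero, norm_zero]
    positivity
  · push Not at h
    have hz3 : ‖z‖ / 3 ≤ bracket z.re := by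
      have h1 := bracket_sq z.re
      have h2 := Complex.sq_norm z
      rw [Complex.normSq_apply] at h2
      have h3 : z.im ^ 2 ≤ (2 * bracket z.re) ^ 2 := sq_le_sq' (by linarith [neg_abs_le z.im])
        (by linarith [le_abs_self z.im])
      have : ‖z‖ ≤ 3 * bracket z.re := by
        refine abs_le_of_sq_le_sq' ?_ (by positivity) |>.2
        nlinarith
      linarith
    have hτb : |τ z.re z.im| ≤ 1 + 2 * |K| :=
      norm_cutoff_le hτ (fun x y => ((hK x y).2).trans (by
        have := bracket_pos x; gcongr; exact le_abs_self K)) _ _ h.le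
    calc ‖almostAnalytic n τ f z.re z.im‖
        = ‖formalTaylor n f z.re z.im‖ * |τ z.re z.im| := by
          rw [almostAnalytic, norm_mul, Complex.norm_real, Real.norm_eq_abs]; rfl
      _ ≤ (C * bracket z.re ^ β) * (1 + 2 * |K|) := by
          have := hCb _ _ h.le
          gcongr
      _ ≤ (C * (‖z‖ / 3) ^ β) * (1 + 2 * |K|) := by
          gcongr ?_ * _
          exact mul_le_mul_of_nonneg_left
            (Real.rpow_le_rpow_of_nonpos (by positivity) hz3 hβ.le) hC
      _ = _ := by ring

/-- The basic estimate `∂f̃/∂z̄ = O(⟨x⟩^{β - 1} (|y| / ⟨x⟩)^n)` for the almost analytic extension;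
where the cut-off is not constant, `|y| / ⟨x⟩` is bounded below. -/
theorem exists_norm_dbar_almostAnalytic_le {β : ℝ} {f : ℝ → ℂ} (hf : f ∈ symbolClass β)
    {τ : ℝ → ℝ → ℝ} (hτ : IsCutoff τ) (n : ℕ) :
    ∃ C : ℝ, 0 ≤ C ∧ ∀ x y : ℝ,
      ‖dbar (almostAnalytic n τ f) x y‖ ≤ C * bracket x ^ (β - 1) * (|y| / bracket x) ^ n ∧
      (2 * bracket x < |y| → dbar (almostAnalytic n τ f) x y = 0) := by
  obtain ⟨C, hC, hCb⟩ := exists_norm_formalTaylor_le hf n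
  obtain ⟨K, hK⟩ := hτ.deriv_bound
  obtain ⟨c, hc, hcb⟩ := hf.2 (n + 1)
  have hK0 : 0 ≤ K := by
    have := (abs_nonneg _).trans (hK 0 0).1
    have hb := bracket_pos 0
    by_contra hneg
    have := div_neg_of_neg_of_pos (not_le.1 hneg) hb
    linarith
  have hzero : ∀ x y : ℝ, 2 * bracket x < |y| → dbar (almostAnalytic n τ f) x y = 0 := by
    intro x y hy
    have h1 : (fun t : ℝ => almostAnalytic n τ f t y) =ᶠ[𝓝 x] fun _ => 0 := by
      filter_upwards [(continuous_const.mul continuous_bracket).continuousAt.eventually_lt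
        continuousAt_const hy] with t ht
      rw [almostAnalytic, hτ.eq_zero _ _ ht.le]; simp
    have h2 : (fun t : ℝ => almostAnalytic n τ f x t) =ᶠ[𝓝 y] fun _ => 0 := by
      filter_upwards [continuousAt_const.eventually_lt continuous_abs.continuousAt hy] with t ht
      rw [almostAnalytic, hτ.eq_zero _ _ ht.le]; simp
    rw [dbar, h1.deriv_eq, h2.deriv_eq]; simp
  refine ⟨c * (1 + 2 * K) + C * (2 * K), by positivity, fun x y => ⟨?_, hzero x y⟩⟩
  have hb := bracket_pos x
  by_cases hy : 2 * bracket x < |y|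
  · rw [hzero x y hy, norm_zero]; positivity
  push Not at hy
  obtain ⟨a, b, ha, hb', hab⟩ := exists_hasDerivAt_formalTaylor hf.1 n x y
  have hτx : DifferentiableAt ℝ (fun t => τ t y) x :=
    ((hτ.smooth.comp (contDiff_prodMk_left y)).differentiable (by simp)) x
  have hτy : DifferentiableAt ℝ (fun t => τ x t) y :=
    ((hτ.smooth.comp (contDiff_prodMk_right x)).differentiable (by simp)) y
  set p := deriv (fun t => τ t y) x with hp
  set q := deriv (fun t => τ x t) y with hq
  have h1 : HasDerivAt (fun t => almostAnalytic n τ f t y)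
      (a * (τ x y : ℂ) + formalTaylor n f x y * (p : ℂ)) x :=
    ha.mul hτx.hasDerivAt.ofReal_comp
  have h2 : HasDerivAt (fun t => almostAnalytic n τ f x t)
      (b * (τ x y : ℂ) + formalTaylor n f x y * (q : ℂ)) y :=
    hb'.mul hτy.hasDerivAt.ofReal_comp
  have hformula : dbar (almostAnalytic n τ f) x y = (1 / 2 : ℂ) *
      (iteratedDeriv (n + 1) f x * (Complex.I * (y : ℂ)) ^ n / (n.factorial : ℂ) * (τ x y : ℂ)
        + formalTaylor n f x y * ((p : ℂ) + Complex.I * (q : ℂ))) := by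
    rw [dbar, h1.deriv, h2.deriv, ← hab]; ring
  have hT1 : ‖iteratedDeriv (n + 1) f x * (Complex.I * (y : ℂ)) ^ n / (n.factorial : ℂ)
      * (τ x y : ℂ)‖ ≤ c * (1 + 2 * K) * (bracket x ^ (β - 1) * (|y| / bracket x) ^ n) := by
    have hfac : (1 : ℝ) ≤ (n.factorial : ℝ) := by exact_mod_cast n.factorial_pos
    rw [norm_mul, norm_div, norm_mul, norm_pow, norm_mul, Complex.norm_I, one_mul,
      Complex.norm_real, Complex.norm_natCast, Complex.norm_real, Real.norm_eq_abs,
      Real.norm_eq_abs]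
    have hτb := norm_cutoff_le hτ (fun x y => (hK x y).2) x y hy
    calc ‖iteratedDeriv (n + 1) f x‖ * |y| ^ n / (n.factorial : ℝ) * |τ x y|
        ≤ ‖iteratedDeriv (n + 1) f x‖ * |y| ^ n * |τ x y| := by
          gcongr
          exact div_le_self (by positivity) hfac
      _ ≤ (c * bracket x ^ (β - ((n + 1 : ℕ) : ℝ))) * |y| ^ n * (1 + 2 * K) := by
          have := hcb x
          gcongr
      _ = _ := by
          have : bracket x ^ (β - ((n + 1 : ℕ) : ℝ)) = bracket x ^ (β - 1) / bracket x ^ n := by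
            rw [← Real.rpow_natCast, ← Real.rpow_sub hb]; congr 1; push_cast; ring
          rw [this, div_pow]; ring
  have hT2 : ‖formalTaylor n f x y * ((p : ℂ) + Complex.I * (q : ℂ))‖
      ≤ C * (2 * K) * (bracket x ^ (β - 1) * (|y| / bracket x) ^ n) := by
    by_cases hy1 : |y| < bracket x
    · have hp0 : p = 0 := by
        have : (fun t : ℝ => τ t y) =ᶠ[𝓝 x] fun _ => 1 := by
          filter_upwards [continuousAt_const.eventually_lt continuous_bracket.continuousAt hy1]
            with t ht
          exact hτ.eq_one _ _ ht.le
        rw [hp, this.deriv_eq, deriv_const]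
      have hq0 : q = 0 := by
        have : (fun t : ℝ => τ x t) =ᶠ[𝓝 y] fun _ => 1 := by
          filter_upwards [continuous_abs.continuousAt.eventually_lt continuousAt_const hy1]
            with t ht
          exact hτ.eq_one _ _ ht.le
        rw [hq, this.deriv_eq, deriv_const]
      rw [hp0, hq0]
      simp only [Complex.ofReal_zero, mul_zero, add_zero, norm_zero]
      positivity
    · push Not at hy1
      have hone : (1 : ℝ) ≤ (|y| / bracket x) ^ n := one_le_pow₀ ((one_le_div hb).2 hy1)
      have hpq : ‖(p : ℂ) + Complex.I * (q : ℂ)‖ ≤ 2 * K / bracket x := by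
        refine (norm_add_le _ _).trans ?_
        rw [norm_mul, Complex.norm_I, one_mul, Complex.norm_real, Complex.norm_real,
          Real.norm_eq_abs, Real.norm_eq_abs]
        have h1 := (hK x y).1
        have h2 := (hK x y).2
        calc |p| + |q| ≤ K / bracket x + K / bracket x := add_le_add h1 h2
          _ = _ := by ring
      rw [norm_mul]
      calc ‖formalTaylor n f x y‖ * ‖(p : ℂ) + Complex.I * (q : ℂ)‖
          ≤ (C * bracket x ^ β) * (2 * K / bracket x) := by
            have := hCb x y hy
            gcongr
        _ = C * (2 * K) * (bracket x ^ (β - 1) * 1) := by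
            rw [Real.rpow_sub_one hb.ne']; ring
        _ ≤ _ := by gcongr
  rw [hformula, norm_mul]
  calc ‖(1 / 2 : ℂ)‖ * _ ≤ 1 * (_ + _) := by
        gcongr
        · norm_num
        · exact (norm_add_le _ _).trans (add_le_add hT1 hT2)
    _ = _ := by ring

/-! ### Absolute convergence -/

/-- The weight `|t|^{s - 1}` on `[-2, 2]`, extended by zero. -/
noncomputable def truncatedPower (s t : ℝ) : ℝ := if |t| ≤ 2 then |t| ^ (s - 1) else 0

theorem truncatedPower_nonneg (s t : ℝ) : 0 ≤ truncatedPower s t := by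
  unfold truncatedPower
  split_ifs <;> positivity

theorem measurable_truncatedPower (s : ℝ) : Measurable (truncatedPower s) := by
  unfold truncatedPower
  exact Measurable.ite (measurableSet_le (by fun_prop) (by fun_prop)) (by fun_prop) (by fun_prop)

theorem integrable_truncatedPower {s : ℝ} (hs : 0 < s) : Integrable (truncatedPower s) := by
  have h1 : IntervalIntegrable (fun t : ℝ => t ^ (s - 1)) volume 0 2 :=
    intervalIntegral.intervalIntegrable_rpow' (by linarith)
  rw [intervalIntegrable_iff_integrableOn_Ioc_of_le (by norm_num)] at h1
  have h2 : Integrable ((Set.Ioc (0 : ℝ) 2).indicator fun t : ℝ => t ^ (s - 1)) :=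
    (integrable_indicator_iff measurableSet_Ioc).2 h1
  refine (h2.add h2.comp_neg).mono' (measurable_truncatedPower s).aestronglyMeasurable ?_
  have hne : ∀ᵐ t : ℝ, t ≠ 0 := by simp [ae_iff]
  filter_upwards [hne] with t ht
  rw [Real.norm_of_nonneg (truncatedPower_nonneg s t)]
  simp only [Pi.add_apply, Set.indicator_apply, Set.mem_Ioc, truncatedPower]
  rcases ht.lt_or_gt with h | h
  · rw [abs_of_neg h, if_neg (c := 0 < t ∧ t ≤ 2) (by intro h'; linarith [h'.1]), zero_add]
    have : 0 < -t := by linarith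
    simp [this]
  · rw [abs_of_pos h, if_neg (c := 0 < -t ∧ -t ≤ 2) (by intro h'; linarith [h'.1]), add_zero]
    simp [h]

theorem integrable_bracket_rpow {r : ℝ} (hr : r < -1) :
    Integrable fun x : ℝ => bracket x ^ r := by
  have h := integrable_rpow_neg_one_add_norm_sq (E := ℝ) (μ := volume) (r := -r)
    (by simp; linarith)
  refine h.congr (Eventually.of_forall fun x => ?_)
  simp only [bracket]
  rw [Real.sqrt_eq_rpow, ← Real.rpow_mul (by positivity)]
  congr 1; ring

/-- The dominating function of the Helffer–Sjöstrand integrand: its integral over `y` is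
`⟨x⟩^{r + 1}` times a constant, by scaling. -/
theorem integrable_bracket_rpow_mul_truncatedPower {r s : ℝ} (hr : r < -2) (hs : 0 < s) :
    Integrable (fun p : ℝ × ℝ => bracket p.1 ^ r * truncatedPower s (p.2 / bracket p.1))
      (volume.prod volume) := by
  have hm : Measurable
      fun p : ℝ × ℝ => bracket p.1 ^ r * truncatedPower s (p.2 / bracket p.1) := by
    have hb : Measurable fun p : ℝ × ℝ => bracket p.1 :=
      continuous_bracket.measurable.comp measurable_fst
    exact (hb.pow_const r).mul ((measurable_truncatedPower s).comp (measurable_snd.div hb))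
  rw [integrable_prod_iff hm.aestronglyMeasurable]
  refine ⟨Eventually.of_forall fun x => ?_, ?_⟩
  · exact ((integrable_truncatedPower hs).comp_div (bracket_pos x).ne').const_mul (bracket x ^ r)
  · have hfun : (fun x : ℝ => ∫ y : ℝ, ‖bracket x ^ r * truncatedPower s (y / bracket x)‖)
        = fun x => bracket x ^ (r + 1) * ∫ t : ℝ, truncatedPower s t := by
      funext x
      have hb := bracket_pos x
      simp_rw [Real.norm_of_nonneg
        (mul_nonneg (Real.rpow_nonneg hb.le r) (truncatedPower_nonneg s _))]
      rw [integral_const_mul, Measure.integral_comp_div (truncatedPower s), abs_of_pos hb,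
        Real.rpow_add_one hb.ne', smul_eq_mul, mul_assoc]
    rw [hfun]
    exact (integrable_bracket_rpow (by linarith)).mul_const _

theorem integrable_dbar_smul {E : Type*} [NormedAddCommGroup E] [NormedSpace ℂ E] {β : ℝ}
    (hβ : β < 0) {f : ℝ → ℂ} (hf : f ∈ symbolClass β) {τ : ℝ → ℝ → ℝ} (hτ : IsCutoff τ)
    {n : ℕ} {c α : ℝ} (hα : 0 ≤ α) (hc : 0 ≤ c) (hn : α < n) {R : ℂ → E}
    (hR : ContinuousOn R {z : ℂ | z.im ≠ 0})
    (hres : ∀ z : ℂ, z.im ≠ 0 → ‖R z‖ ≤ c * |z.im|⁻¹ * (bracket z / |z.im|) ^ α) :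
    Integrable (fun z : ℂ => dbar (almostAnalytic n τ f) z.re z.im • R z) volume := by
  obtain ⟨C, hC, hCb⟩ := exists_norm_dbar_almostAnalytic_le hf hτ n
  have hn0 : n ≠ 0 := by rintro rfl; simp at hn; linarith
  have hdom : Integrable (fun z : ℂ => C * (c * 3 ^ α) *
      (bracket z.re ^ (β - 2) * truncatedPower (n - α) (z.im / bracket z.re))) volume := by
    have h := integrable_bracket_rpow_mul_truncatedPower (r := β - 2) (s := n - α) (by linarith)
      (by linarith)
    exact (Complex.volume_preserving_equiv_real_prod.integrable_comp_of_integrable h).const_mul _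
  have hset : MeasurableSet {z : ℂ | z.im ≠ 0} :=
    (isOpen_ne_fun Complex.continuous_im continuous_const).measurableSet
  -- On the real axis the factor `|y|^n` vanishes because `n ≠ 0`.
  have hzero : ∀ z : ℂ, z.im = 0 → dbar (almostAnalytic n τ f) z.re z.im = 0 := by
    intro z hz
    have := (hCb z.re z.im).1
    rw [hz, abs_zero, zero_div, zero_pow hn0, mul_zero] at this
    rw [hz]
    exact norm_le_zero_iff.1 this
  have hmeas : AEStronglyMeasurable
      (fun z : ℂ => dbar (almostAnalytic n τ f) z.re z.im • R z) volume := by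
    have hF : ContDiff ℝ 1 (fun p : ℝ × ℝ => almostAnalytic n τ f p.1 p.2) :=
      (contDiff_almostAnalytic hf.1 hτ n).of_le (by exact_mod_cast le_top)
    have hd : Continuous fun z : ℂ => dbar (almostAnalytic n τ f) z.re z.im :=
      continuous_dbar_re_im hF
    have h1 := (hd.continuousOn.smul hR).aestronglyMeasurable (μ := volume) hset
    have h2 := (aestronglyMeasurable_indicator_iff hset).2 h1
    refine h2.congr (Eventually.of_forall fun z => ?_)
    by_cases hz : z.im = 0
    · rw [Set.indicator_of_notMem (by simpa using hz)]
      simp only [hzero z hz, zero_smul]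
    · rw [Set.indicator_of_mem (by simpa using hz)]
      rfl
  refine hdom.mono' hmeas (Eventually.of_forall fun z => ?_)
  have hb := bracket_pos z.re
  have hnn := truncatedPower_nonneg (n - α) (z.im / bracket z.re)
  rw [norm_smul]
  by_cases hz : z.im = 0
  · rw [hzero z hz, norm_zero, zero_mul]; positivity
  by_cases hbig : 2 * bracket z.re < |z.im|
  · rw [(hCb z.re z.im).2 hbig, norm_zero, zero_mul]; positivity
  push Not at hbig
  have hy : 0 < |z.im| := abs_pos.2 hz
  set b := bracket z.re with hbdef
  set t := |z.im| / b with ht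
  have ht0 : 0 < t := by positivity
  have htr : truncatedPower (n - α) (z.im / b) = t ^ ((n : ℝ) - α - 1) := by
    rw [truncatedPower, abs_div, abs_of_pos hb, if_pos ((div_le_iff₀ hb).2 hbig)]
  have hbr : bracket z ≤ 3 * b := by
    have h1 := bracket_sq z.re
    have h2 := Complex.sq_norm z
    rw [Complex.normSq_apply] at h2
    have h3 : z.im ^ 2 ≤ (2 * b) ^ 2 := sq_le_sq' (by linarith [neg_abs_le z.im])
      (by linarith [le_abs_self z.im])
    refine (Real.sqrt_le_left (by positivity)).2 ?_
    nlinarith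
  have hquot : bracket z / |z.im| ≤ 3 / t := by
    rw [ht, div_div_eq_mul_div]; gcongr
  have hb0 : 0 ≤ bracket z := Real.sqrt_nonneg _
  calc ‖dbar (almostAnalytic n τ f) z.re z.im‖ * ‖R z‖
      ≤ (C * b ^ (β - 1) * t ^ n) * (c * |z.im|⁻¹ * (3 / t) ^ α) := by
        refine mul_le_mul (hCb z.re z.im).1 ((hres z hz).trans ?_) (norm_nonneg _) (by positivity)
        gcongr
    _ = C * (c * 3 ^ α) * (b ^ (β - 2) * t ^ ((n : ℝ) - α - 1)) := by
        have h1 : |z.im|⁻¹ = b⁻¹ * t⁻¹ := by rw [ht]; field_simp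
        have h2 : b ^ (β - 2) = b ^ (β - 1) * b⁻¹ := by
          rw [show β - 2 = β - 1 - 1 by ring, Real.rpow_sub_one hb.ne', div_eq_mul_inv]
        have h3 : t ^ ((n : ℝ) - α - 1) = t ^ n * t⁻¹ / t ^ α := by
          rw [Real.rpow_sub_one ht0.ne', Real.rpow_sub ht0, Real.rpow_natCast]; ring
        rw [h1, h2, h3, Real.div_rpow (by norm_num) ht0.le]
        ring
    _ = _ := by rw [htr]

/-! ### Characters of the double commutant -/

section DoubleCommutant

variable {E : Type*} [NormedRing E] [NormedAlgebra ℂ E]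

/-- The double commutant `S''` of a subset `S` of a Banach algebra. -/
abbrev doubleCommutant (S : Set E) : Subalgebra ℂ E :=
  Subalgebra.centralizer ℂ (Set.centralizer S)

instance completeSpace_doubleCommutant [CompleteSpace E] (S : Set E) :
    CompleteSpace (doubleCommutant S) :=
  (Set.isClosed_centralizer (Set.centralizer S)).completeSpace_coe

theorem isUnit_doubleCommutant {S : Set E} {a : doubleCommutant S} (ha : IsUnit (a : E)) :
    IsUnit a := by
  obtain ⟨u, hu⟩ := ha
  have hmem : ((u⁻¹ : Eˣ) : E) ∈ doubleCommutant S := by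
    intro g hg
    have h : Commute g (u : E) := hu ▸ a.2 g hg
    exact h.units_inv_right
  exact isUnit_iff_exists.2 ⟨(⟨_, hmem⟩ : doubleCommutant S),
    Subtype.ext (by simp [← hu]), Subtype.ext (by simp [← hu])⟩

/-- For commuting `S`, the double commutant of `S` is a commutative Banach algebra closed under
inverses, so spectra of its elements, even those taken in the ambient algebra, are values of
characters. -/
theorem exists_algHom_eq_of_mem_spectrum [CompleteSpace E] {S : Set E}
    (hS : ∀ x ∈ S, ∀ y ∈ S, x * y = y * x) {a : doubleCommutant S} {l : ℂ}
    (hl : l ∈ spectrum ℂ (a : E)) :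
    ∃ χ : doubleCommutant S →ₐ[ℂ] ℂ, Continuous χ ∧ χ a = l := by
  let _ : NormedCommRing (doubleCommutant S) :=
    { (inferInstance : NormedRing (doubleCommutant S)) with
      mul_comm := fun x y => Subtype.ext
        (Set.centralizer_centralizer_comm_of_comm hS _ x.2 _ y.2) }
  have hla : l ∈ spectrum ℂ a := by
    intro h
    exact hl (h.map (doubleCommutant S).val)
  obtain ⟨χ, hχ⟩ := WeakDual.CharacterSpace.mem_spectrum_iff_exists.1 hla
  exact ⟨WeakDual.CharacterSpace.toAlgHom χ, map_continuous χ, hχ⟩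

end DoubleCommutant

theorem integral_algHom_comp {A₁ A₂ X : Type*} [NormedRing A₁] [NormedAlgebra ℂ A₁]
    [CompleteSpace A₁] [NormedRing A₂] [NormedAlgebra ℂ A₂] [CompleteSpace A₂]
    [MeasurableSpace X] {ν : Measure X} (χ : A₁ →ₐ[ℂ] A₂) (hχ : Continuous χ) {G : X → A₁}
    (hG : Integrable G ν) : ∫ x, χ (G x) ∂ν = χ (∫ x, G x ∂ν) :=
  ContinuousLinearMap.integral_comp_comm (⟨χ.toLinearMap, hχ⟩ : A₁ →L[ℂ] A₂) hG

/-! ### The scalar formula and the spectral inclusion -/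

/-- The scalar solutions of the resolvent identity are zero and `z ↦ (z - μ)⁻¹`. -/
theorem eq_zero_or_eq_inv_sub_of_resolvent_identity {ρ : Set ℂ} {r : ℂ → ℂ}
    (h : ∀ z ∈ ρ, ∀ w ∈ ρ, r z * (1 + (z - w) * r w) = r w) :
    (∀ z ∈ ρ, r z = 0) ∨ ∃ μ ∉ ρ, ∀ z ∈ ρ, r z = (z - μ)⁻¹ := by
  by_cases h0 : ∀ z ∈ ρ, r z = 0
  · exact Or.inl h0
  push Not at h0
  obtain ⟨w, hw, hrw⟩ := h0
  have key : ∀ z ∈ ρ, r z * (z - (w - (r w)⁻¹)) = 1 := by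
    intro z hz
    have := h z hz w hw
    field_simp
    linear_combination this
  refine Or.inr ⟨w - (r w)⁻¹, fun hμ => ?_, fun z hz => eq_inv_of_mul_eq_one_left (key z hz)⟩
  simpa using key _ hμ

theorem mem_closure_image_add_of_unbounded {β : ℝ} (hβ : β < 0) {f : ℝ → ℂ}
    (hf : f ∈ symbolClass β) (γ : ℂ) {S : Set ℝ} (hS : ∀ M : ℝ, ∃ x ∈ S, M < |x|) :
    γ ∈ closure ((fun x => γ + f x) '' S) := by
  obtain ⟨c, hc, hcb⟩ := hf.2 0
  rw [Metric.mem_closure_iff]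
  intro ε hε
  have hlim : Tendsto (fun t : ℝ => c * t ^ β) atTop (𝓝 0) := by
    simpa using (tendsto_rpow_neg_atTop (neg_pos.2 hβ)).const_mul c
  obtain ⟨M, hM⟩ := eventually_atTop.1 (hlim.eventually_lt_const hε)
  obtain ⟨x, hx, hMx⟩ := hS (max M 0)
  refine ⟨_, ⟨x, hx, rfl⟩, ?_⟩
  have hx0 : 0 < |x| := (le_max_right _ _).trans_lt hMx
  have hxb : |x| ≤ bracket x := by
    refine Real.le_sqrt_of_sq_le ?_
    rw [Real.norm_eq_abs]; linarith
  have h1 := hcb x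
  rw [iteratedDeriv_zero, Nat.cast_zero, sub_zero] at h1
  rw [dist_eq_norm, sub_add_cancel_left, norm_neg]
  calc ‖f x‖ ≤ c * bracket x ^ β := h1
    _ ≤ c * |x| ^ β :=
      mul_le_mul_of_nonneg_left (Real.rpow_le_rpow_of_nonpos hx0 hxb hβ.le) hc.le
    _ < ε := hM _ ((le_max_left _ _).trans hMx.le)

/-- The Helffer–Sjöstrand formula for a scalar `x ∈ ℝ` in place of `H`, up to the factor `-π⁻¹`:
the Cauchy–Pompeiu formula for `f̃`, which restricts to `f` on the real axis. -/
theorem integral_dbar_almostAnalytic_smul_inv {β : ℝ} (hβ : β < 0) {f : ℝ → ℂ}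
    (hf : f ∈ symbolClass β) {τ : ℝ → ℝ → ℝ} (hτ : IsCutoff τ) {n : ℕ} (hn : 0 < n) (x : ℝ) :
    ∫ z : ℂ, dbar (almostAnalytic n τ f) z.re z.im • (z - (x : ℂ))⁻¹ = -Real.pi * f x := by
  have hne : ∀ z : ℂ, z.im ≠ 0 → z - (x : ℂ) ≠ 0 := by
    intro z hz h
    apply hz
    rw [sub_eq_zero.1 h, Complex.ofReal_im]
  have hint : Integrable
      (fun z : ℂ => dbar (almostAnalytic n τ f) z.re z.im • (z - (x : ℂ))⁻¹) volume := by
    refine integrable_dbar_smul hβ hf hτ (c := 1) (α := 0) le_rfl zero_le_one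
      (by exact_mod_cast hn) ?_ fun z hz => ?_
    · exact ContinuousOn.inv₀ (by fun_prop) hne
    · rw [Real.rpow_zero, mul_one, one_mul, norm_inv]
      refine inv_anti₀ (abs_pos.2 hz) ?_
      simpa using Complex.abs_im_le_norm (z - (x : ℂ))
  have hF : ContDiff ℝ 1 (fun p : ℝ × ℝ => almostAnalytic n τ f p.1 p.2) :=
    (contDiff_almostAnalytic hf.1 hτ n).of_le (by exact_mod_cast le_top)
  have h := integral_dbar_smul_inv hF (tendsto_almostAnalytic_cobounded hβ hf hτ n) x hint
  rw [h, Complex.ofReal_re, Complex.ofReal_im]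
  congr 1
  rw [almostAnalytic, hτ.eq_one x 0 (by simpa using (bracket_pos x).le),
    Finset.sum_eq_single_of_mem 0 (by simp) (fun r _ hr => by simp [hr])]
  simp

end HelfferSjostrand

open HelfferSjostrand

theorem mainTheorem1 {B : Type*} [NormedAddCommGroup B] [NormedSpace ℂ B] [CompleteSpace B]
    (H : B →ₗ.[ℂ] B) (hclosed : H.IsClosed) (hdense : Dense (H.domain : Set B))
    (hreal : HelfferSjostrand.spectrumOf H ⊆ Set.range (fun x : ℝ => (x : ℂ)))
    (c α : ℝ) (hα : 0 ≤ α)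
    (hres : ∀ z : ℂ, z.im ≠ 0 →
      ‖HelfferSjostrand.resolventOf H z‖
        ≤ c * |z.im|⁻¹ * (HelfferSjostrand.bracket z / |z.im|) ^ α)
    (n : ℕ) (hn : α < (n : ℝ))
    (τ : ℝ → ℝ → ℝ) (hτ : HelfferSjostrand.IsCutoff τ)
    (φ : HelfferSjostrand.slowAlgebraHat) :
    Integrable (HelfferSjostrand.calcIntegrand H n τ (φ.snd : ℝ → ℂ)) volume ∧
      spectrum ℂ (HelfferSjostrand.funcCalcHat H n τ φ)
        ⊆ closure (HelfferSjostrand.evalHat φ ''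
            {x : ℝ | (x : ℂ) ∈ HelfferSjostrand.spectrumOf H}) := by
  obtain ⟨β, hβ, hf⟩ : ∃ β : ℝ, β < 0 ∧ (φ.snd : ℝ → ℂ) ∈ symbolClass β := by
    have h : (φ.snd : ℝ → ℂ) ∈ ⋃ β : ℝ, ⋃ _ : β < 0, symbolClass β := φ.snd.2
    simpa only [Set.mem_iUnion, exists_prop] using h
  have hn0 : 0 < n := by
    have : (0 : ℝ) < n := hα.trans_lt hn
    exact_mod_cast this
  have hc : 0 ≤ c := by
    have h := (norm_nonneg _).trans (hres Complex.I (by simp))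
    rw [Complex.I_im, abs_one, inv_one, mul_one, div_one] at h
    have hb : 0 < bracket Complex.I := by unfold bracket; positivity
    exact nonneg_of_mul_nonneg_left h (Real.rpow_pos_of_pos hb α)
  have hmem : ∀ z : ℂ, z.im ≠ 0 → z ∈ resolventSetOf H := by
    intro z hz
    by_contra h
    obtain ⟨x, rfl⟩ := hreal h
    simp at hz
  have hcont : ContinuousOn (resolventOf H) {z : ℂ | z.im ≠ 0} :=
    (differentiableOn_resolventOf (isOpen_ne_fun Complex.continuous_im continuous_const)
      hmem).continuousOn
  have hint : Integrable (calcIntegrand H n τ (φ.snd : ℝ → ℂ)) volume := by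
    unfold calcIntegrand
    exact integrable_dbar_smul (R := resolventOf H) hβ hf hτ hα hc hn hcont hres
  refine ⟨hint, fun l hl => ?_⟩
  set S : Set (B →L[ℂ] B) := resolventOf H '' resolventSetOf H with hS
  have hSR : ∀ z, resolventOf H z ∈ doubleCommutant S := by
    intro z
    by_cases hz : z ∈ resolventSetOf H
    · exact Set.subset_centralizer_centralizer (Set.mem_image_of_mem _ hz)
    · rw [resolventOf_eq_zero hz]; exact zero_mem _
  set R : ℂ → doubleCommutant S := fun z => ⟨resolventOf H z, hSR z⟩ with hR
  set G : ℂ → doubleCommutant S := fun z =>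
    dbar (almostAnalytic n τ (φ.snd : ℝ → ℂ)) z.re z.im • R z with hG
  have hRcont : ContinuousOn R {z : ℂ | z.im ≠ 0} :=
    Topology.IsInducing.subtypeVal.continuousOn_iff.2 hcont
  have hGint : Integrable G volume :=
    integrable_dbar_smul (R := R) hβ hf hτ hα hc hn hRcont hres
  set a : doubleCommutant S :=
    φ.fst • (1 : doubleCommutant S) + (-((1 / Real.pi : ℝ) : ℂ)) • ∫ z, G z with ha
  have hcoe : (a : B →L[ℂ] B) = funcCalcHat H n τ φ := by
    have h' : ((∫ z, G z : doubleCommutant S) : B →L[ℂ] B)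
        = ∫ z : ℂ, calcIntegrand H n τ (φ.snd : ℝ → ℂ) z :=
      (integral_algHom_comp (doubleCommutant S).val continuous_subtype_val hGint).symm
    rw [funcCalcHat, funcCalc, ← h']
    rfl
  rw [← hcoe] at hl
  obtain ⟨χ, hχ, hχa⟩ := exists_algHom_eq_of_mem_spectrum (by
    rintro _ ⟨z, hz, rfl⟩ _ ⟨w, hw, rfl⟩
    exact resolventOf_commute hz hw) hl
  have hval : l = φ.fst + (-((1 / Real.pi : ℝ) : ℂ))
      * ∫ z : ℂ, dbar (almostAnalytic n τ (φ.snd : ℝ → ℂ)) z.re z.im • χ (R z) := by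
    have h' : χ (∫ z, G z)
        = ∫ z : ℂ, dbar (almostAnalytic n τ (φ.snd : ℝ → ℂ)) z.re z.im • χ (R z) := by
      rw [← integral_algHom_comp χ hχ hGint]
      exact integral_congr_ae (Eventually.of_forall fun z => map_smul χ _ _)
    rw [← hχa, ha, map_add, map_smul, map_smul, map_one, h', smul_eq_mul, smul_eq_mul, mul_one]
  have hident : ∀ z ∈ resolventSetOf H, ∀ w ∈ resolventSetOf H,
      χ (R z) * (1 + (z - w) * χ (R w)) = χ (R w) := by
    intro z hz w hw
    have h : R z * (1 + (z - w) • R w) = R w := Subtype.ext (resolventOf_mul_one_add hz hw)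
    simpa using congrArg χ h
  have hnull : ∀ᵐ z : ℂ, z.im ≠ 0 := by
    have h : ∀ᵐ p : ℝ × ℝ, p.2 ≠ 0 :=
      Measure.quasiMeasurePreserving_snd.ae (by simp [ae_iff] : ∀ᵐ y : ℝ, y ≠ 0)
    exact Complex.volume_preserving_equiv_real_prod.quasiMeasurePreserving.ae h
  rcases eq_zero_or_eq_inv_sub_of_resolvent_identity hident with h0 | ⟨μ, hμ, hinv⟩
  · -- A character that kills every resolvent belongs to the point at infinity.
    have hl' : l = φ.fst := by
      rw [hval, integral_congr_ae (g := fun _ => (0 : ℂ)) ?_]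
      · simp
      · filter_upwards [hnull] with z hz
        rw [h0 z (hmem z hz), smul_zero]
    rw [hl']
    refine mem_closure_image_add_of_unbounded hβ hf φ.fst fun M => ?_
    by_contra hbdd
    push Not at hbdd
    have hU : {z : ℂ | max M 1 < ‖z‖} ⊆ resolventSetOf H := by
      intro z hz
      by_contra hzs
      obtain ⟨x, rfl⟩ := hreal hzs
      have h1 : |x| ≤ M := hbdd x hzs
      have h2 : max M 1 < ‖(x : ℂ)‖ := hz
      rw [Complex.norm_real, Real.norm_eq_abs] at h2
      linarith [le_max_left M 1]
    obtain ⟨z, hz, hunit⟩ :=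
      exists_isUnit_resolventOf hdense (le_max_right M 1) hc hn.le hU hres
    have hχz : IsUnit (χ (R z)) := (isUnit_doubleCommutant (a := R z) hunit).map χ
    rw [h0 z hz] at hχz
    exact not_isUnit_zero hχz
  · -- Otherwise it is evaluation at a point of the spectrum.
    obtain ⟨x, rfl⟩ := hreal hμ
    refine subset_closure ⟨x, hμ, ?_⟩
    have hI : ∫ z : ℂ, dbar (almostAnalytic n τ (φ.snd : ℝ → ℂ)) z.re z.im • χ (R z)
        = -Real.pi * (φ.snd : ℝ → ℂ) x := by
      rw [← integral_dbar_almostAnalytic_smul_inv hβ hf hτ hn0 x]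
      refine integral_congr_ae ?_
      filter_upwards [hnull] with z hz
      rw [hinv z (hmem z hz)]
    have hpi : (Real.pi : ℂ) ≠ 0 := by exact_mod_cast Real.pi_ne_zero
    rw [hval, hI, evalHat]
    push_cast
    field_simp
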